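/- **Setting.** Let $d_1,d_2\ge 0$, $N\ge 1$, $d_3\ge Nd_1+1$, and let $D\subseteq\mathbb R^{d_1}$ be a Borel set. An observation is a pair $\mathcal O=(\mathcal X,x_{\rm else})$, where $\mathcal X\subseteq D$ is a set with at least one and at most $N$ elements and $x_{\rm else}\in\mathbb R^{d_2}$; $\overline{\mathcal O}$ is the set of observations (a subset is measurable if, for each $M\le N$, its preimage under $(x_1,\dots,x_M,x_{\rm else})\mapsto(\{x_1,\dots,x_M\},x_{\rm else})$ is Borel). Let $\mathcal A$ be a finite action set, $p(\cdot\mid\mathcal O,a)$ a transition kernel on $\overline{\mathcal O}$, $r(\mathcal O,a,\mathcal O')$ a bounded measurable reward, $\gamma\in(0,1)$ and $\alpha>0$. A policy $\pi$ is a Markov kernel from $\overline{\mathcal O}$ to $\mathcal A$. Along a trajectory started at $(\mathcal O_0,a_0)=(\mathcal O,a)$ and continued with $\pi$, put $$Z^\pi(\mathcal O,a)=r_0+\sum_{i\ge 1}\gamma^i\big[r_i-\alpha\log\pi(a_i\mid\mathcal O_i)\big],\qquad r_i=r(\mathcal O_i,a_i,\mathcal O_{i+1}),$$ let $\mathcal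 Z^\pi(\cdot\mid\mathcal O,a)$ be its law and $Q^\pi(\mathcal O,a)=\mathbb E[Z^\pi(\mathcal O,a)]$. For a kernel $\mathcal Z$ of laws on $\mathbb R$, $\mathcal T^\pi\mathcal Z(\cdot\mid\mathcal O,a)$ is the law of $r(\mathcal O,a,\mathcal O')+\gamma\,(Z-\alpha\log\pi(a'\mid\mathcal O'))$, where $\mathcal O'\sim p(\cdot\mid\mathcal O,a)$, $a'\sim\pi(\cdot\mid\mathcal O')$, $Z\sim\mathcal Z(\cdot\mid\mathcal O',a')$. For an initial distribution $\mu$ on $\overline{\mathcal O}$, let $\rho_\pi^\mu=(1-\gamma)\sum_t\gamma^t\,\mathrm{Law}(\mathcal O_t,a_t)$, where $\mathcal O_0\sim\mu$ and all actions are drawn from $\pi$. **Networks.** There are parametric families of feature networks $h(\cdot;\phi):\mathbb R^{d_1}\to\mathbb R^{d_3}$, value networks $\mathcal Z(\cdot\mid s,a;\theta)$ (laws on $\mathbb R$) and policy networks $\pi(\cdot\mid s;\omega)$ (laws on $\mathcal A$), $s\in\mathbb R^{d_3+d_2}$. They are over-parameterized in the idealised sense that each family consists of exactly all measurable maps, respectively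 all Markov kernels, of its type. The encoding is $U(\mathcal O;\phi)=\big[\sum_{x\in\mathcal X}h(x;\phi),\,x_{\rm else}\big]$. **Algorithm.** Fix a set $I$ of initial distributions and parameters $\theta_{0,0},\phi_{0,0},\omega_0$. A run consists of parameters $\theta_{k,i},\phi_{k,i},\omega_k$ ($k,i\ge 0$) with these initial values. Write $\mathcal Z_{k,i}(\cdot\mid\mathcal O,a)=\mathcal Z(\cdot\mid U(\mathcal O;\phi_{k,i}),a;\theta_{k,i})$ and $\pi_k(\cdot\mid\mathcal O)=\pi(\cdot\mid U(\mathcal O;\phi_{k,0});\omega_k)$. For all $k,i$ and all $\mu\in I$: 1. (evaluation step) $(\theta_{k,i+1},\phi_{k,i+1})$ minimises over $(\theta,\phi)$ $$\mathbb E_{(\mathcal O,a)\sim\rho_{\pi_k}^\mu}\,D_{\rm KL}\big(\mathcal T^{\pi_k}\mathcal Z_{k,i}(\cdot\mid\mathcal O,a),\ \mathcal Z(\cdot\mid U(\mathcal O;\phi),a;\theta)\big);$$ 2. (outcome of evaluation) if, for every $\nu\in I$, $\mathcal Z_{k,i}$ converges weakly as $i\to\infty$ to some kernel $\mathcal Z$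 for $\rho^\nu_{\pi_k}$-almost every $(\mathcal O,a)$, then $\mathcal Z_{k+1,0}=\mathcal Z$ $\rho^\mu_{\pi_k}$-almost everywhere; 3. (improvement) $\omega_{k+1}$ maximises over $\omega$ $$\mathbb E_{\mathcal O\sim\rho_{\pi_k}^\mu,\,a\sim\pi(\cdot\mid s;\omega)}\big[Q(s,a;\theta_{k+1,0})-\alpha\log\pi(a\mid s;\omega)\big],\qquad s=U(\mathcal O;\phi_{k+1,0}),$$ where $Q(s,a;\theta)$ is the mean of $\mathcal Z(\cdot\mid s,a;\theta)$. Assume that $\pi_0(a\mid\mathcal O)>0$ for all $(\mathcal O,a)$, that the first absolute moment of $\mathcal Z_{0,0}(\cdot\mid\mathcal O,a)$ is bounded uniformly in $(\mathcal O,a)$, and that the sampling distributions cover the environment: every measurable $B\subseteq\overline{\mathcal O}$ with $\rho_{\pi_0}^\mu(B\times\mathcal A)=0$ for all $\mu\in I$ satisfies $p(B\mid\mathcal O,a)=0$ for all $(\mathcal O,a)$. (This is automatic if $I$ contains all point masses; the objectives are then minimised and maximised at every observation, and "almost every" below means "every".) **Theorem (Encoding Distributional Policy Iteration).** There is a policy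 $\pi^*$ with $Q^{\pi^*}(\mathcal O,a)\ge Q^{\pi}(\mathcal O,a)$ for every policy $\pi$ and all $(\mathcal O,a)\in\overline{\mathcal O}\times\mathcal A$. A run with the given initial parameters exists, and every such run converges to $\pi^*$. In detail, for every such run: * for all $k$ and all $\mu\in I$, for $\rho^\mu_{\pi_k}$-almost every $(\mathcal O,a)$, $\mathcal Z_{k,i}(\cdot\mid\mathcal O,a)\to\mathcal Z^{\pi_k}(\cdot\mid\mathcal O,a)$ weakly as $i\to\infty$, and $\mathcal Z_{k+1,0}(\cdot\mid\mathcal O,a)=\mathcal Z^{\pi_k}(\cdot\mid\mathcal O,a)$; * for all $\mu\in I$, for $\rho^\mu_{\pi_0}$-almost every $(\mathcal O,a_0)$, $\pi_k(a\mid\mathcal O)\to\pi^*(a\mid\mathcal O)$ as $k\to\infty$ for every $a\in\mathcal A$; * $Q^{\pi_k}(\mathcal O,a)\to Q^{\pi^*}(\mathcal O,a)$ as $k\to\infty$ for all $(\mathcal O,a)\in\overline{\mathcal O}\times\mathcal A$. -/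

import Mathlib

open MeasureTheory ProbabilityTheory
open scoped ENNReal NNReal

namespace EncodingDPI

/-! ## Entropy-regularised decision processes -/

/-- Markov kernels from `X` to `Y`: measurable families of probability laws on `Y` indexed by `X`. -/
abbrev MarkovKernel (X Y : Type*) [MeasurableSpace X] [MeasurableSpace Y] :=
  {κ : Kernel X Y // IsMarkovKernel κ}

instance {X Y : Type*} [MeasurableSpace X] [MeasurableSpace Y] (κ : MarkovKernel X Y) :
    IsMarkovKernel κ.1 := κ.2

/-- A discounted decision process on the observation space `S` with action space `A`: transition
law `p(s' | s, a)`, reward `r(s, a, s')`, discount factor `γ ∈ (0, 1)` and entropy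
coefficient `α > 0`. -/
structure DecisionProcess (S A : Type*) [MeasurableSpace S] [MeasurableSpace A] where
  transition : MarkovKernel (S × A) S
  reward : S → A → S → ℝ
  measurable_reward : Measurable fun x : S × A × S => reward x.1 x.2.1 x.2.2
  γ : ℝ
  γ_pos : 0 < γ
  γ_lt_one : γ < 1
  α : ℝ
  α_pos : 0 < α

/-- A stochastic policy `π(a | s)`. -/
abbrev Policy (S A : Type*) [MeasurableSpace S] [MeasurableSpace A] := MarkovKernel S A

/-- A candidate state-action return distribution `𝒵(· | s, a)`. -/
abbrev ReturnDist (S A : Type*) [MeasurableSpace S] [MeasurableSpace A] := MarkovKernel (S × A) ℝ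

/-- The probability `π(a | s)`. -/
noncomputable def Policy.prob {S A : Type*} [MeasurableSpace S] [MeasurableSpace A]
    (π : Policy S A) (s : S) (a : A) : ℝ := (π.1 s).real {a}

namespace DecisionProcess

variable {S A : Type*} [MeasurableSpace S] [MeasurableSpace A] (M : DecisionProcess S A)

/-- One step of the process under `π`: from `(s, a)`, draw `s' ∼ p(· | s, a)`, then
`a' ∼ π(· | s')`. -/
noncomputable def step (π : Policy S A) : Kernel (S × A) (S × A) :=
  M.transition.1.compProd (Kernel.prodMkLeft (S × A) π.1)

instance (π : Policy S A) : IsMarkovKernel (M.step π) := by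
  unfold step; infer_instance

/-- The law of the whole trajectory `(s₀, a₀), (s₁, a₁), …` started at a given `(s₀, a₀)` and
continued by following `π` (the Ionescu-Tulcea measure). -/
noncomputable def trajectory (π : Policy S A) : Kernel (S × A) (ℕ → S × A) :=
  (Kernel.traj (X := fun _ => S × A)
      (fun n => (M.step π).comap
        (fun h : (i : Finset.Iic n) → S × A => h ⟨n, Finset.mem_Iic.2 le_rfl⟩)
        (measurable_pi_apply _)) 0).comap
    (fun (x : S × A) (_ : Finset.Iic 0) => x) (measurable_pi_lambda _ fun _ => measurable_id)

/-- The entropy-augmented return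
`r₀ + ∑_{i ≥ 1} γ ^ i (r_i - α log π(a_i | s_i))` along a trajectory. -/
noncomputable def ret (π : Policy S A) (τ : ℕ → S × A) : ℝ :=
  M.reward (τ 0).1 (τ 0).2 (τ 1).1 +
    ∑' i : ℕ, M.γ ^ (i + 1) * (M.reward (τ (i + 1)).1 (τ (i + 1)).2 (τ (i + 2)).1
      - M.α * Real.log (π.prob (τ (i + 1)).1 (τ (i + 1)).2))

/-- `𝒵^π(· | s, a)`: the law of the return from `(s, a)` under `π`. -/
noncomputable def returnLaw (π : Policy S A) (s : S) (a : A) : Measure ℝ :=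
  (M.trajectory π (s, a)).map (M.ret π)

/-- `Q^π(s, a)`: the expected return from `(s, a)` under `π`. -/
noncomputable def Q (π : Policy S A) (s : S) (a : A) : ℝ :=
  ∫ τ, M.ret π τ ∂(M.trajectory π (s, a))

/-- The distributional Bellman operator: `(𝒯^π 𝒵)(· | s, a)` is the law of
`r(s, a, s') + γ (Z - α log π(a' | s'))`, where `s' ∼ p(· | s, a)`, `a' ∼ π(· | s')` and
`Z ∼ 𝒵(· | s', a')`. -/
noncomputable def bellman (π : Policy S A) (Z : ReturnDist S A) (x : S × A) : Measure ℝ :=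
  ((M.step π x).compProd Z.1).map fun y : (S × A) × ℝ =>
    M.reward x.1 x.2 y.1.1 + M.γ * (y.2 - M.α * Real.log (π.prob y.1.1 y.1.2))

/-- `ρ_π`: the (normalised discounted) observation-action distribution
`(1 - γ) ∑_t γ ^ t Law(s_t, a_t)` induced by `π` when `s₀ ∼ μ`. -/
noncomputable def occupancy (π : Policy S A) (μ : ProbabilityMeasure S) : Measure (S × A) :=
  Measure.sum fun t : ℕ => ENNReal.ofReal ((1 - M.γ) * M.γ ^ t) •
    (((μ : Measure S).compProd π.1).bind (M.trajectory π)).map fun τ => τ t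

/-- The policy evaluation objective `E_{ρ_π} [D_KL (𝒯^π 𝒵_old(· | s, a), 𝒵(· | s, a))]`. -/
noncomputable def evalObjective (π : Policy S A) (μ : ProbabilityMeasure S)
    (Zold Z : ReturnDist S A) : ℝ≥0∞ :=
  ∫⁻ x, InformationTheory.klDiv (M.bellman π Zold x) (Z.1 x) ∂(M.occupancy π μ)

/-- The policy improvement objective
`E_{s ∼ ρ_{π_old}, a ∼ π} [E[Z(s, a)] - α log π(a | s)]`, where `Z(s, a) ∼ 𝒵(· | s, a)`. -/
noncomputable def improveObjective (πold : Policy S A) (μ : ProbabilityMeasure S)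
    (Z : ReturnDist S A) (π : Policy S A) : ℝ :=
  ∫ x, ∫ a, ((∫ z, z ∂(Z.1 (x.1, a))) - M.α * Real.log (π.prob x.1 a)) ∂(π.1 x.1)
    ∂(M.occupancy πold μ)

/-- The sampling distributions `ρ_π` obtained from the initial distributions in `I` jointly charge
every set of observations that the environment can enter. It holds trivially when `I` contains all
Dirac masses. -/
def Explores (π : Policy S A) (I : Set (ProbabilityMeasure S)) : Prop :=
  ∀ B : Set S, MeasurableSet B → (∀ μ ∈ I, M.occupancy π μ (B ×ˢ Set.univ) = 0) →
    ∀ x, M.transition.1 x B = 0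

end DecisionProcess

/-! ## Observations and the encoding by summation and concatenation -/

/-- An observation: a set of between `1` and `N` indicator vectors of surrounding vehicles, each in
the domain `D ⊆ ℝ^d₁`, together with a vector of `ℝ^d₂` of other indicators. -/
@[ext]
structure Observation {d₁ : ℕ} (D : Set (Fin d₁ → ℝ)) (N d₂ : ℕ) where
  vehicles : Finset (Fin d₁ → ℝ)
  nonempty : vehicles.Nonempty
  card_le : vehicles.card ≤ N
  mem_domain : ∀ x ∈ vehicles, x ∈ D
  other : Fin d₂ → ℝ

/-- The state space `ℝ^(d₃ + d₂)`, as pairs (sum of encodings, other indicators). -/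
abbrev State (d₃ d₂ : ℕ) := (Fin d₃ → ℝ) × (Fin d₂ → ℝ)

section Encoding

variable {d₁ : ℕ} {D : Set (Fin d₁ → ℝ)} {N d₂ d₃ : ℕ}

open Classical in
/-- The observation `({x₁, …, x_M}, x_else)` given by a list of `M = m + 1` vectors. -/
noncomputable def Observation.ofTuple (m : Fin N) (t : (Fin (m + 1) → D) × (Fin d₂ → ℝ)) :
    Observation D N d₂ where
  vehicles := Finset.univ.image fun i => (t.1 i : Fin d₁ → ℝ)
  nonempty := Finset.univ_nonempty.image _
  card_le := Finset.card_image_le.trans (by simp)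
  mem_domain := by
    intro x hx
    obtain ⟨i, -, rfl⟩ := Finset.mem_image.1 hx
    exact (t.1 i).2
  other := t.2

/-- The σ-algebra on observations: a set of observations is measurable when, for each
`1 ≤ M ≤ N`, it is measurable as a set of tuples `(x₁, …, x_M, x_else)`. -/
noncomputable instance : MeasurableSpace (Observation D N d₂) :=
  ⨅ m : Fin N, MeasurableSpace.map (Observation.ofTuple m) inferInstance

/-- The encoding `U_ESC(O) = [∑_{x ∈ 𝒳} h(x), x_else]`. -/
def esc (h : (Fin d₁ → ℝ) → (Fin d₃ → ℝ)) (O : Observation D N d₂) : State d₃ d₂ :=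
  (∑ x ∈ O.vehicles, h x, O.other)

theorem measurable_of_comp_ofTuple {Y : Type*} [MeasurableSpace Y] {f : Observation D N d₂ → Y}
    (hf : ∀ m : Fin N, Measurable fun t => f (Observation.ofTuple m t)) : Measurable f := by
  intro s hs
  rw [MeasurableSpace.measurableSet_iInf]
  exact fun m => hf m hs

open Classical in
theorem sum_image_univ {n : ℕ} {X E : Type*} [AddCommMonoid E] (t : Fin n → X) (h : X → E) :
    ∑ x ∈ Finset.univ.image t, h x = ∑ i, if ∀ j < i, t j ≠ t i then h (t i) else 0 := by
  rw [← Finset.sum_filter]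
  have himg : Finset.univ.image t
      = (Finset.univ.filter fun i => ∀ j < i, t j ≠ t i).image t := by
    ext x
    simp only [Finset.mem_image, Finset.mem_univ, true_and, Finset.mem_filter]
    constructor
    · rintro ⟨i, rfl⟩
      induction i using WellFoundedLT.induction with
      | ind i ih =>
        by_cases hi : ∀ j < i, t j ≠ t i
        · exact ⟨i, hi, rfl⟩
        · push Not at hi
          obtain ⟨j, hj, hji⟩ := hi
          rw [← hji]
          exact ih j hj
    · rintro ⟨i, -, rfl⟩
      exact ⟨i, rfl⟩
  rw [himg, Finset.sum_image]
  intro i hi j hj hij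
  simp only [Finset.coe_filter, Finset.mem_univ, true_and, Set.mem_ofPred_eq] at hi hj
  rcases lt_trichotomy i j with hlt | heq | hgt
  · exact absurd hij (hj i hlt)
  · exact heq
  · exact absurd hij.symm (hi j hgt)

theorem measurable_esc {h : (Fin d₁ → ℝ) → (Fin d₃ → ℝ)} (hh : Measurable h) :
    Measurable (esc h : Observation D N d₂ → State d₃ d₂) := by
  classical
  refine measurable_of_comp_ofTuple fun m => Measurable.prodMk ?_ measurable_snd
  have key : ∀ t : (Fin (m + 1) → D) × (Fin d₂ → ℝ),
      ∑ x ∈ (Observation.ofTuple m t).vehicles, h x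
        = ∑ i, if ∀ j < i, (t.1 j : Fin d₁ → ℝ) ≠ t.1 i then h (t.1 i) else 0 := by
    intro t
    convert sum_image_univ (fun i => (t.1 i : Fin d₁ → ℝ)) h
    ext x
    simp [Observation.ofTuple]
  simp_rw [key]
  have hm : ∀ i : Fin (m + 1), Measurable fun t : (Fin (m + 1) → D) × (Fin d₂ → ℝ) =>
      (t.1 i : Fin d₁ → ℝ) := fun i =>
    measurable_subtype_coe.comp ((measurable_pi_apply i).comp measurable_fst)
  refine Finset.measurable_sum _ fun i _ => Measurable.ite ?_ (hh.comp (hm i)) measurable_const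
  simp only [Set.ofPred_forall]
  refine MeasurableSet.iInter fun j => MeasurableSet.iInter fun _ => ?_
  exact (measurableSet_eq_fun (hm j) (hm i)).compl

variable {A : Type*} [MeasurableSpace A]

/-- A feature map `h : ℝ^d₁ → ℝ^d₃`. -/
abbrev Feature (d₁ d₃ : ℕ) := {h : (Fin d₁ → ℝ) → (Fin d₃ → ℝ) // Measurable h}

/-- The policy `O ↦ π(· | U_ESC(O))` on observations. -/
noncomputable def encodePolicy (D : Set (Fin d₁ → ℝ)) (N : ℕ) (h : Feature d₁ d₃)
    (π : Policy (State d₃ d₂) A) : Policy (Observation D N d₂) A :=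
  ⟨π.1.comap (esc h.1) (measurable_esc h.2), inferInstance⟩

/-- The return distribution `(O, a) ↦ 𝒵(· | U_ESC(O), a)` on observations. -/
noncomputable def encodeReturn (D : Set (Fin d₁ → ℝ)) (N : ℕ) (h : Feature d₁ d₃)
    (Z : ReturnDist (State d₃ d₂) A) : ReturnDist (Observation D N d₂) A :=
  ⟨Z.1.comap (fun x => (esc h.1 x.1, x.2))
    (((measurable_esc h.2).comp measurable_fst).prodMk measurable_snd), inferInstance⟩

end Encoding

/-! ## Encoding distributional policy iteration -/

/-- The parametric families: feature networks `h(·; φ)`, value networks `𝒵(· | s, a; θ)` and policy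
networks `π(· | s; ω)`. -/
structure Networks (d₁ d₂ d₃ : ℕ) (A : Type*) [MeasurableSpace A] (Φ Θ Ω : Type*) where
  feature : Φ → Feature d₁ d₃
  value : Θ → ReturnDist (State d₃ d₂) A
  policy : Ω → Policy (State d₃ d₂) A

/-- Idealised over-parameterisation: every measurable feature map, return distribution and policy
is represented exactly by some parameter. -/
structure Networks.OverParameterized {d₁ d₂ d₃ : ℕ} {A : Type*} [MeasurableSpace A]
    {Φ Θ Ω : Type*} (net : Networks d₁ d₂ d₃ A Φ Θ Ω) : Prop where
  feature : Function.Surjective net.feature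
  value : Function.Surjective net.value
  policy : Function.Surjective net.policy

section Iteration

variable {d₁ d₂ d₃ N : ℕ} {D : Set (Fin d₁ → ℝ)} {A : Type*} [MeasurableSpace A] {Φ Θ Ω : Type*}

/-- `O ↦ π(· | U_ESC(O; φ); ω)`. -/
noncomputable def Networks.obsPolicy (net : Networks d₁ d₂ d₃ A Φ Θ Ω) (D : Set (Fin d₁ → ℝ))
    (N : ℕ) (φ : Φ) (ω : Ω) : Policy (Observation D N d₂) A :=
  encodePolicy D N (net.feature φ) (net.policy ω)

/-- `(O, a) ↦ 𝒵(· | U_ESC(O; φ), a; θ)`. -/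
noncomputable def Networks.obsReturn (net : Networks d₁ d₂ d₃ A Φ Θ Ω) (D : Set (Fin d₁ → ℝ))
    (N : ℕ) (φ : Φ) (θ : Θ) : ReturnDist (Observation D N d₂) A :=
  encodeReturn D N (net.feature φ) (net.value θ)

/-- The parameters visited by the algorithm: `θ k i`, `φ k i` are the value and feature parameters
after `i` updates in the `k`-th policy evaluation, and `ω k` is the policy parameter at the
`k`-th iteration. -/
structure Params (Φ Θ Ω : Type*) where
  θ : ℕ → ℕ → Θ
  φ : ℕ → ℕ → Φ
  ω : ℕ → Ω

/-- The policy `π_k` on observations at iteration `k`. It is encoded by the feature parameter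
at which it was computed, that is, the outcome `φ k 0` of the preceding evaluation, and it stays
fixed while the feature network is updated in the `k`-th evaluation. -/
noncomputable def Params.pol (P : Params Φ Θ Ω) (net : Networks d₁ d₂ d₃ A Φ Θ Ω)
    (D : Set (Fin d₁ → ℝ)) (N : ℕ) (k : ℕ) : Policy (Observation D N d₂) A :=
  net.obsPolicy D N (P.φ k 0) (P.ω k)

/-- The return distribution on observations after `i` updates in the `k`-th evaluation. -/
noncomputable def Params.val (P : Params Φ Θ Ω) (net : Networks d₁ d₂ d₃ A Φ Θ Ω)
    (D : Set (Fin d₁ → ℝ)) (N : ℕ) (k i : ℕ) : ReturnDist (Observation D N d₂) A :=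
  net.obsReturn D N (P.φ k i) (P.θ k i)

/-- Weak convergence of laws on `ℝ`. -/
def WeaklyConverges (ν : ℕ → Measure ℝ) (ν' : Measure ℝ) : Prop :=
  ∀ f : BoundedContinuousFunction ℝ ℝ,
    Filter.Tendsto (fun i => ∫ z, f z ∂(ν i)) Filter.atTop (nhds (∫ z, f z ∂ν'))

/-- `P` is a run of encoding distributional policy iteration started from `θ₀, φ₀, ω₀`, with
sampling distributions `ρ_π` built from the initial distributions in `I`. -/
structure IsEncodingDPI (M : DecisionProcess (Observation D N d₂) A)
    (net : Networks d₁ d₂ d₃ A Φ Θ Ω) (I : Set (ProbabilityMeasure (Observation D N d₂)))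
    (θ₀ : Θ) (φ₀ : Φ) (ω₀ : Ω) (P : Params Φ Θ Ω) : Prop where
  init_value : P.θ 0 0 = θ₀
  init_feature : P.φ 0 0 = φ₀
  init_policy : P.ω 0 = ω₀
  /-- Evaluation update: `{θ, φ}` jointly minimise the evaluation objective. -/
  eval_step : ∀ k i, ∀ μ ∈ I, ∀ θ φ,
    M.evalObjective (P.pol net D N k) μ (P.val net D N k i) (P.val net D N k (i + 1)) ≤
      M.evalObjective (P.pol net D N k) μ (P.val net D N k i) (net.obsReturn D N φ θ)
  /-- Evaluation is carried on until convergence: if the iterates converge to a return distribution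
  `Z`, then the parameters `θ (k + 1) 0`, `φ (k + 1) 0` that evaluation delivers represent `Z`,
  almost everywhere for the sampling distributions. That the iterates do converge is not part of
  this definition. -/
  eval_limit : ∀ k, ∀ Z : ReturnDist (Observation D N d₂) A,
    (∀ μ ∈ I, ∀ᵐ x ∂(M.occupancy (P.pol net D N k) μ),
      WeaklyConverges (fun i => (P.val net D N k i).1 x) (Z.1 x)) →
    ∀ μ ∈ I, ∀ᵐ x ∂(M.occupancy (P.pol net D N k) μ), (P.val net D N (k + 1) 0).1 x = Z.1 x
  /-- Improvement: `ω` maximises the improvement objective for the evaluated return distribution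
  and the evaluated feature network. -/
  improve : ∀ k, ∀ μ ∈ I, ∀ ω,
    M.improveObjective (P.pol net D N k) μ (P.val net D N (k + 1) 0)
        (net.obsPolicy D N (P.φ (k + 1) 0) ω) ≤
      M.improveObjective (P.pol net D N k) μ (P.val net D N (k + 1) 0)
        (P.pol net D N (k + 1))

end Iteration

end EncodingDPI

open EncodingDPI

/-! The encoding can be made lossless. Code a point by the real number whose digits in base N + 2
record which sets of a countable basis contain it. In a sum over at most N points the digits count
the points in each basic set, with no carries, so the sum determines the finite set
(`digits_eq_zero`, `exists_measurable_sum_injective`). The resulting encoding is an injective Borel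
map, and by Lusin–Souslin a measurable embedding (`measurableEmbedding_esc`), so every kernel on
observations factors through it. Hence the evaluation objective has minimum 0, and a vanishing
divergence forces each iterate to be the Bellman image of the previous one, almost everywhere.
Improvement needs no injectivity: the softmax of encoded action values is already a function of the
encoding.

What remains is soft policy iteration on an abstract state space. By the Markov property the return
law is fixed by the Bellman operator (`bellman_returnKernel`), which contracts integrals of bounded
Lipschitz functions by γ; this gives weak convergence of evaluation. By Gibbs' principle the soft
maximum exceeds the regularised value of π by α times the divergence of π from the softmax weights
(`softValue_sub_polValue`), so the improved policy is the softmax of Q^{π_k}. If F is the soft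
Bellman optimality operator and q its fixed point, then F Q^{π_k} ≤ Q^{π_{k+1}} ≤ q, and the error
decays like γ^k.

The objectives see only almost every point, so null sets need care. One step of the chain sends the
law at time t to that at time t + 1, so Bellman images respect almost-everywhere equality.
Positivity of π_0 and of softmax weights keeps all sampling distributions equivalent to the first
one (`IsPolicyIteration.invariant`). Coverage then passes to almost every successor of every state,
which is all that a Bellman backup sees. -/

namespace EncodingDPI

/-! ## Markov chains with a stationary kernel -/

section Chain

variable {X : Type*} [MeasurableSpace X]

/-- The law of the Markov chain with one-step kernel `κ`, as a kernel of its starting point. -/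
noncomputable def chain (κ : Kernel X X) [IsMarkovKernel κ] : Kernel X (ℕ → X) :=
  (Kernel.traj (X := fun _ => X)
      (fun n => κ.comap
        (fun h : (i : Finset.Iic n) → X => h ⟨n, Finset.mem_Iic.2 le_rfl⟩)
        (measurable_pi_apply _)) 0).comap
    (fun (x : X) (_ : Finset.Iic 0) => x) (measurable_pi_lambda _ fun _ => measurable_id)

variable (κ : Kernel X X) [IsMarkovKernel κ]

instance : IsMarkovKernel (chain κ) := by unfold chain; infer_instance

theorem chain_map_zero (x : X) : (chain κ x).map (fun τ => τ 0) = Measure.dirac x := by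
  have h : (fun τ : ℕ → X => τ 0) = (fun h : (i : Finset.Iic 0) → X =>
      h ⟨0, Finset.mem_Iic.2 le_rfl⟩) ∘ Preorder.frestrictLe (π := fun _ => X) 0 := rfl
  rw [h, ← Measure.map_map (measurable_pi_apply _) (by fun_prop), chain, Kernel.comap_apply,
    Kernel.traj_map_frestrictLe_apply, Kernel.partialTraj_self, Kernel.id_apply,
    Measure.map_dirac' (measurable_pi_apply _)]

/-- By Ionescu-Tulcea, the first n + 2 coordinates are the composition-product of the first n + 1
with the one-step kernel, so the last coordinate can be integrated out. -/
theorem lintegral_chain_prod_succ (x : X) (n : ℕ) (f : ℕ → X → ℝ≥0∞) (hf : ∀ i, Measurable (f i)) :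
    ∫⁻ τ, ∏ i ∈ Finset.range (n + 2), f i (τ i) ∂(chain κ x) =
      ∫⁻ τ, (∏ i ∈ Finset.range (n + 1), f i (τ i)) * (∫⁻ y, f (n + 1) y ∂(κ (τ n)))
        ∂(chain κ x) := by
  set κ' : (n : ℕ) → Kernel ((i : Finset.Iic n) → X) X := fun n => κ.comap
        (fun h : (i : Finset.Iic n) → X => h ⟨n, Finset.mem_Iic.2 le_rfl⟩)
        (measurable_pi_apply _) with hκ'
  set x₀ : (i : Finset.Iic 0) → X := fun _ => x
  have hc : chain κ x = Kernel.traj (X := fun _ => X) κ' 0 x₀ := rfl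
  have key := Kernel.partialTraj_compProd_eq_map_traj (X := fun _ => X) (κ := κ')
    (Nat.zero_le n) (x₀ := x₀)
  let G : ((i : Finset.Iic n) → X) → ℝ≥0∞ := fun h =>
    ∏ i ∈ (Finset.range (n + 1)).attach,
      f i (h ⟨i, Finset.mem_Iic.2 (Nat.lt_succ_iff.1 (Finset.mem_range.1 i.2))⟩)
  have hG : Measurable G :=
    Finset.measurable_prod _ fun i _ => (hf i).comp (measurable_pi_apply _)
  have hGτ : ∀ τ : ℕ → X, G (Preorder.frestrictLe (π := fun _ => X) n τ)
      = ∏ i ∈ Finset.range (n + 1), f i (τ i) := by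
    intro τ
    exact Finset.prod_attach (Finset.range (n + 1)) (fun i => f i (τ i))
  have h1 : ∫⁻ τ, ∏ i ∈ Finset.range (n + 2), f i (τ i) ∂(chain κ x) =
      ∫⁻ p, G p.1 * f (n + 1) p.2 ∂((chain κ x).map
        (fun τ => (Preorder.frestrictLe (π := fun _ => X) n τ, τ (n + 1)))) := by
    rw [lintegral_map]
    · refine lintegral_congr fun τ => ?_
      rw [Finset.prod_range_succ, hGτ]
    · exact (hG.comp measurable_fst).mul ((hf _).comp measurable_snd)
    · fun_prop
  have hGf : Measurable fun p : ((i : Finset.Iic n) → X) × X => G p.1 * f (n + 1) p.2 :=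
    (hG.comp measurable_fst).mul ((hf _).comp measurable_snd)
  rw [h1, hc, ← key, Measure.lintegral_compProd hGf,
    ← Kernel.traj_map_frestrictLe_apply, lintegral_map]
  · refine lintegral_congr fun τ => ?_
    rw [← hGτ]
    exact lintegral_const_mul (G (Preorder.frestrictLe (π := fun _ => X) n τ)) (hf (n + 1))
      (μ := κ (τ n))
  · have : Measurable fun a : (i : Finset.Iic n) → X => ∫⁻ b, f (n + 1) b ∂(κ' n a) :=
      (hf _).lintegral_kernel
    simp_rw [fun a => lintegral_const_mul (μ := κ' n a) (G a) (hf (n + 1))]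
    exact hG.mul this
  · fun_prop

/-- Prepending a point to a path. -/
def cons (x : X) (τ : ℕ → X) : ℕ → X := fun n => Nat.casesOn n x τ

omit [MeasurableSpace X] in
@[simp] theorem cons_zero (x : X) (τ : ℕ → X) : cons x τ 0 = x := rfl

omit [MeasurableSpace X] in
@[simp] theorem cons_succ (x : X) (τ : ℕ → X) (n : ℕ) : cons x τ (n + 1) = τ n := rfl

theorem measurable_cons (x : X) : Measurable (cons x) := by
  refine measurable_pi_lambda _ fun n => ?_
  cases n with
  | zero => exact measurable_const
  | succ n => exact measurable_pi_apply n

/-- The Markov property at time 1 for product functions. The construction of the chain gives access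
to its last step, so the induction removes factors from the end until only the first step is left.
-/
theorem lintegral_chain_prod (n : ℕ) (f : ℕ → X → ℝ≥0∞) (hf : ∀ i, Measurable (f i)) (x : X) :
    ∫⁻ τ, ∏ i ∈ Finset.range (n + 2), f i (τ i) ∂(chain κ x) =
      f 0 x * ∫⁻ y, ∫⁻ τ, ∏ i ∈ Finset.range (n + 1), f (i + 1) (τ i) ∂(chain κ y) ∂(κ x) := by
  have h0 : ∀ (g : X → ℝ≥0∞), Measurable g → ∀ y, ∫⁻ τ, g (τ 0) ∂(chain κ y) = g y := by
    intro g hg y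
    rw [← lintegral_map hg (measurable_pi_apply 0), chain_map_zero, lintegral_dirac' _ hg]
  have hm : ∀ i, Measurable fun y => ∫⁻ z, f i z ∂(κ y) := fun i => (hf i).lintegral_kernel
  induction n generalizing f with
  | zero =>
    rw [lintegral_chain_prod_succ κ x 0 f hf]
    simp only [zero_add, Finset.range_one, Finset.prod_singleton]
    rw [h0 (fun z => f 0 z * ∫⁻ y, f 1 y ∂(κ z)) ((hf 0).mul (hm 1)) x]
    simp_rw [h0 _ (hf 1)]
  | succ n ih =>
    rw [lintegral_chain_prod_succ κ x (n + 1) f hf]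
    -- The last factor, integrated against `κ`, is absorbed into factor n + 1. The product becomes
    -- shorter, and the same absorption undoes this on the shifted side.
    let f' : ℕ → X → ℝ≥0∞ := fun i z =>
      if i = n + 1 then f i z * ∫⁻ y, f (n + 2) y ∂(κ z) else f i z
    have hf' : ∀ i, Measurable (f' i) := by
      intro i
      by_cases hi : i = n + 1
      · simp only [f', hi, if_true]; exact (hf _).mul (hm _)
      · simp only [f', hi, if_false]; exact hf i
    have e1 : ∀ τ : ℕ → X, (∏ i ∈ Finset.range (n + 1 + 1), f i (τ i)) *
        (∫⁻ y, f (n + 1 + 1) y ∂(κ (τ (n + 1)))) = ∏ i ∈ Finset.range (n + 2), f' i (τ i) := by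
      intro τ
      rw [Finset.prod_range_succ, Finset.prod_range_succ _ (n + 1)]
      have : ∏ i ∈ Finset.range (n + 1), f' i (τ i) = ∏ i ∈ Finset.range (n + 1), f i (τ i) := by
        refine Finset.prod_congr rfl fun i hi => ?_
        simp [f', (Finset.mem_range.1 hi).ne]
      rw [this]
      simp [f', mul_assoc]
    simp_rw [e1]
    rw [ih f' hf' (fun i => (hf' i).lintegral_kernel)]
    have e2 : f' 0 x = f 0 x := by simp [f']
    rw [e2]
    congr 1
    refine lintegral_congr fun y => ?_
    rw [lintegral_chain_prod_succ κ y n (fun i => f (i + 1)) (fun i => hf _)]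
    refine lintegral_congr fun τ => ?_
    rw [Finset.prod_range_succ, Finset.prod_range_succ _ n]
    have : ∏ i ∈ Finset.range n, f' (i + 1) (τ i) = ∏ i ∈ Finset.range n, f (i + 1) (τ i) := by
      refine Finset.prod_congr rfl fun i hi => ?_
      simp [f', (Finset.mem_range.1 hi).ne]
    rw [this]
    simp [f', mul_assoc]

/-- Square cylinders form a generating π-system, and the indicator of one is a finite product of
functions of single coordinates, with factor 1 at unconstrained times. -/
theorem measure_path_ext {m m' : Measure (ℕ → X)} [IsProbabilityMeasure m]
    [IsProbabilityMeasure m']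
    (h : ∀ (n : ℕ) (f : ℕ → X → ℝ≥0∞), (∀ i, Measurable (f i)) →
      ∫⁻ τ, ∏ i ∈ Finset.range (n + 2), f i (τ i) ∂m =
        ∫⁻ τ, ∏ i ∈ Finset.range (n + 2), f i (τ i) ∂m') : m = m' := by
  classical
  refine ext_of_generate_finite _ generateFrom_squareCylinders.symm
    (isPiSystem_squareCylinders (fun _ => MeasurableSpace.isPiSystem_measurableSet)
      fun _ => MeasurableSet.univ) ?_ (by simp)
  rintro _ ⟨s, t, ht, rfl⟩
  have ht' : ∀ i, MeasurableSet (t i) := fun i => ht i (Set.mem_univ i)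
  set f : ℕ → X → ℝ≥0∞ := fun i => if i ∈ s then (t i).indicator 1 else 1
  have hf : ∀ i, Measurable (f i) := by
    intro i
    by_cases hi : i ∈ s
    · simp only [f, hi, if_true]; exact measurable_one.indicator (ht' i)
    · simp only [f, hi, if_false]; exact measurable_one
  have hs : s ⊆ Finset.range (s.sup id + 2) := by
    intro i hi
    have : i ≤ s.sup id := Finset.le_sup (f := id) hi
    simp only [Finset.mem_range]
    omega
  have e : ∀ τ : ℕ → X, ∏ i ∈ Finset.range (s.sup id + 2), f i (τ i)
      = ((s : Set ℕ).pi t).indicator 1 τ := by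
    intro τ
    rw [← Finset.prod_subset hs (by intro i _ hi; simp [f, hi])]
    by_cases hτ : τ ∈ (s : Set ℕ).pi t
    · rw [Set.indicator_of_mem hτ]
      refine Finset.prod_eq_one fun i hi => ?_
      simp [f, hi, hτ i hi]
    · rw [Set.indicator_of_notMem hτ]
      simp only [Set.mem_pi, not_forall] at hτ
      obtain ⟨i, hi, hi'⟩ := hτ
      have hi2 : i ∈ s := hi
      exact Finset.prod_eq_zero hi2 (by simp [f, hi2, hi'])
  have := h (s.sup id) f hf
  simp_rw [e] at this
  have hms : MeasurableSet ((s : Set ℕ).pi t) :=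
    MeasurableSet.pi (Finset.countable_toSet s) fun i _ => ht' i
  rwa [lintegral_indicator_one hms, lintegral_indicator_one hms] at this

/-- The Markov property at time `1`. -/
theorem lintegral_chain (x : X) {f : (ℕ → X) → ℝ≥0∞} (hf : Measurable f) :
    ∫⁻ τ, f τ ∂(chain κ x) = ∫⁻ y, ∫⁻ τ, f (cons x τ) ∂(chain κ y) ∂(κ x) := by
  have hk : IsMarkovKernel ((chain κ).map (cons x)) := Kernel.IsMarkovKernel.map _ (measurable_cons x)
  have hb : ∀ g : (ℕ → X) → ℝ≥0∞, Measurable g →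
      ∫⁻ τ, g τ ∂((κ x).bind ((chain κ).map (cons x)))
        = ∫⁻ y, ∫⁻ τ, g (cons x τ) ∂(chain κ y) ∂(κ x) := by
    intro g hg
    rw [Measure.lintegral_bind (Kernel.aemeasurable _) hg.aemeasurable]
    refine lintegral_congr fun y => ?_
    rw [Kernel.map_apply _ (measurable_cons x), lintegral_map hg (measurable_cons x)]
  have : IsProbabilityMeasure ((κ x).bind ((chain κ).map (cons x))) := by
    infer_instance
  have heq : chain κ x = (κ x).bind ((chain κ).map (cons x)) := by
    refine measure_path_ext fun n g hg => ?_
    have hprod : Measurable fun τ : ℕ → X => ∏ i ∈ Finset.range (n + 2), g i (τ i) :=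
      Finset.measurable_prod _ fun i _ => (hg i).comp (measurable_pi_apply i)
    rw [hb _ hprod,
      lintegral_chain_prod κ n g hg x]
    have hprod' : Measurable fun τ : ℕ → X => ∏ i ∈ Finset.range (n + 1), g (i + 1) (τ i) :=
      Finset.measurable_prod _ fun i _ => (hg (i + 1)).comp (measurable_pi_apply i)
    have hmeas : Measurable fun y => ∫⁻ τ, ∏ i ∈ Finset.range (n + 1), g (i + 1) (τ i) ∂(chain κ y) :=
      hprod'.lintegral_kernel
    rw [← lintegral_const_mul _ hmeas]
    refine lintegral_congr fun y => ?_
    rw [← lintegral_const_mul _ hprod']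
    refine lintegral_congr fun τ => ?_
    rw [Finset.prod_range_succ' _ (n + 1)]
    simp [mul_comm]
  rw [heq, hb f hf]

/-- The chain starts almost surely at its starting point. -/
theorem lintegral_chain_cons_tail (x : X) {f : (ℕ → X) → ℝ≥0∞} (hf : Measurable f) :
    ∫⁻ τ, f (cons x fun n => τ (n + 1)) ∂(chain κ x) = ∫⁻ τ, f τ ∂(chain κ x) := by
  have h : Measurable fun τ : ℕ → X => f (cons x fun n => τ (n + 1)) :=
    hf.comp ((measurable_cons x).comp (measurable_pi_lambda _ fun n => measurable_pi_apply _))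
  rw [lintegral_chain κ x h, lintegral_chain κ x hf]
  rfl

theorem lintegral_chain_eval_zero (x : X) {f : X → ℝ≥0∞} (hf : Measurable f) :
    ∫⁻ τ, f (τ 0) ∂(chain κ x) = f x := by
  rw [← lintegral_map hf (measurable_pi_apply 0), chain_map_zero, lintegral_dirac' _ hf]

theorem lintegral_chain_eval_succ (x : X) (n : ℕ) {f : X → ℝ≥0∞} (hf : Measurable f) :
    ∫⁻ τ, f (τ (n + 1)) ∂(chain κ x) = ∫⁻ y, ∫⁻ τ, f (τ n) ∂(chain κ y) ∂(κ x) :=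
  lintegral_chain κ x (f := fun τ => f (τ (n + 1))) (hf.comp (measurable_pi_apply _))

/-- Time 0 is excluded because the starting point is arbitrary. For log-probabilities the bound
holds only once the action has been drawn from the policy. -/
theorem lintegral_chain_eval_succ_le {C : ℝ≥0∞} {f : X → ℝ≥0∞} (hf : Measurable f)
    (hC : ∀ x, ∫⁻ y, f y ∂(κ x) ≤ C) (n : ℕ) (x : X) :
    ∫⁻ τ, f (τ (n + 1)) ∂(chain κ x) ≤ C := by
  induction n generalizing x with
  | zero =>
    rw [lintegral_chain_eval_succ κ x 0 hf]
    simp_rw [fun y => lintegral_chain_eval_zero κ y hf]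
    exact hC x
  | succ n ih =>
    rw [lintegral_chain_eval_succ κ x _ hf]
    calc _ ≤ ∫⁻ _, C ∂(κ x) := lintegral_mono fun y => ih y
      _ = C := by simp

end Chain

/-! ## Policies on a finite action set -/

section Policy

variable {S A : Type*} [MeasurableSpace S] [MeasurableSpace A]

theorem Policy.prob_nonneg (π : Policy S A) (s : S) (a : A) : 0 ≤ π.prob s a := measureReal_nonneg

theorem Policy.prob_le_one (π : Policy S A) (s : S) (a : A) : π.prob s a ≤ 1 := measureReal_le_one

theorem Policy.measurable_prob_left [MeasurableSingletonClass A] (π : Policy S A) (a : A) :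
    Measurable fun s => π.prob s a :=
  (Kernel.measurable_coe π.1 (measurableSet_singleton a)).ennreal_toReal

variable [Fintype A] [MeasurableSingletonClass A]

theorem Policy.measurable_prob (π : Policy S A) : Measurable fun y : S × A => π.prob y.1 y.2 :=
  measurable_from_prod_countable_left fun a => π.measurable_prob_left a

theorem Policy.integral_eq (π : Policy S A) (s : S) (f : A → ℝ) :
    ∫ a, f a ∂(π.1 s) = ∑ a, π.prob s a * f a := by
  rw [integral_fintype Integrable.of_finite]
  rfl

theorem Policy.sum_prob (π : Policy S A) (s : S) : ∑ a, π.prob s a = 1 := by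
  have := π.integral_eq s fun _ => 1
  simpa using this.symm

omit [Fintype A] [MeasurableSingletonClass A] in
theorem Policy.ofReal_prob (π : Policy S A) (s : S) (a : A) :
    ENNReal.ofReal (π.prob s a) = π.1 s {a} := by
  simp [Policy.prob]

omit [MeasurableSingletonClass A] in
theorem Policy.ae_iff (π : Policy S A) (s : S) (p : A → Prop) :
    (∀ᵐ a ∂(π.1 s), p a) ↔ ∀ a, 0 < π.prob s a → p a := by
  rw [MeasureTheory.ae_iff]
  constructor
  · intro h a ha
    by_contra hp
    have : π.1 s {a} = 0 := measure_mono_null (by simpa using hp) h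
    simp [Policy.prob, Measure.real, this] at ha
  · intro h
    rw [measure_null_iff_singleton (Set.to_countable _)]
    intro a ha
    have : ¬ 0 < π.prob s a := fun h' => ha (h a h')
    rw [← π.ofReal_prob]
    simpa using this

/-- Log-probabilities are unbounded, but weighted by their own probability they are not. This makes
entropy terms integrable uniformly over all policies. -/
theorem mul_abs_log_le {x : ℝ} (h0 : 0 ≤ x) (h1 : x ≤ 1) : x * |Real.log x| ≤ 1 := by
  rcases h0.eq_or_lt with rfl | hx
  · simp
  · rw [abs_of_nonpos (Real.log_nonpos h0 h1), ← Real.log_inv]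
    have := Real.log_le_sub_one_of_pos (inv_pos.2 hx)
    calc x * Real.log x⁻¹ ≤ x * (x⁻¹ - 1) := by gcongr
      _ = 1 - x := by field_simp
      _ ≤ 1 := by linarith

/-- `log π(a | s)`. -/
noncomputable def Policy.logProb (π : Policy S A) (y : S × A) : ℝ := Real.log (π.prob y.1 y.2)

theorem Policy.measurable_logProb (π : Policy S A) : Measurable π.logProb :=
  Real.measurable_log.comp π.measurable_prob

theorem Policy.lintegral_logProb_le (π : Policy S A) (s : S) :
    ∫⁻ a, ‖π.logProb (s, a)‖ₑ ∂(π.1 s) ≤ Fintype.card A := by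
  rw [lintegral_fintype]
  calc _ ≤ ∑ _a : A, (1 : ℝ≥0∞) := by
        refine Finset.sum_le_sum fun a _ => ?_
        rw [← π.ofReal_prob, ← ofReal_norm, ← ENNReal.ofReal_mul (norm_nonneg _),
          ← ENNReal.ofReal_one]
        refine ENNReal.ofReal_le_ofReal ?_
        rw [mul_comm]
        exact mul_abs_log_le (π.prob_nonneg s a) (π.prob_le_one s a)
    _ = Fintype.card A := by simp

end Policy

/-! ## Return laws and the distributional Bellman operator -/

namespace DecisionProcess

variable {S A : Type*} [MeasurableSpace S] [MeasurableSpace A] (M : DecisionProcess S A)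

theorem trajectory_eq_chain (π : Policy S A) : M.trajectory π = chain (M.step π) := rfl

instance (π : Policy S A) : IsMarkovKernel (M.trajectory π) :=
  inferInstanceAs (IsMarkovKernel (chain (M.step π)))

theorem lintegral_step (π : Policy S A) (x : S × A) {f : S × A → ℝ≥0∞} (hf : Measurable f) :
    ∫⁻ y, f y ∂(M.step π x) = ∫⁻ s, ∫⁻ a, f (s, a) ∂(π.1 s) ∂(M.transition.1 x) := by
  rw [step, Kernel.lintegral_compProd _ _ _ hf]
  rfl

theorem measurable_reward_comp {X : Type*} [MeasurableSpace X] {f g : X → S × A} (hf : Measurable f)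
    (hg : Measurable g) : Measurable fun x => M.reward (f x).1 (f x).2 (g x).1 :=
  M.measurable_reward.comp
    ((measurable_fst.comp hf).prodMk ((measurable_snd.comp hf).prodMk (measurable_fst.comp hg)))

variable [Fintype A] [MeasurableSingletonClass A]

/-- The term of index `i + 1` in the entropy-augmented return. -/
noncomputable def retTerm (π : Policy S A) (i : ℕ) (τ : ℕ → S × A) : ℝ :=
  M.γ ^ (i + 1) * (M.reward (τ (i + 1)).1 (τ (i + 1)).2 (τ (i + 2)).1
      - M.α * π.logProb (τ (i + 1)))

omit [Fintype A] [MeasurableSingletonClass A] in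
theorem ret_eq (π : Policy S A) (τ : ℕ → S × A) :
    M.ret π τ = M.reward (τ 0).1 (τ 0).2 (τ 1).1 + ∑' i, M.retTerm π i τ := rfl

theorem measurable_retTerm (π : Policy S A) (i : ℕ) : Measurable (M.retTerm π i) :=
  ((M.measurable_reward_comp (measurable_pi_apply _) (measurable_pi_apply _)).sub
    ((π.measurable_logProb.comp (measurable_pi_apply _)).const_mul _)).const_mul _

theorem measurable_ret (π : Policy S A) : Measurable (M.ret π) :=
  (M.measurable_reward_comp (measurable_pi_apply _) (measurable_pi_apply _)).add
    (Measurable.tsum fun i => M.measurable_retTerm π i)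

omit [Fintype A] [MeasurableSingletonClass A] in
theorem retTerm_cons_zero (π : Policy S A) (x : S × A) (τ : ℕ → S × A) :
    M.retTerm π 0 (cons x τ) =
      M.γ * (M.reward (τ 0).1 (τ 0).2 (τ 1).1 - M.α * π.logProb (τ 0)) := by
  simp only [retTerm, zero_add, pow_one]
  rfl

omit [Fintype A] [MeasurableSingletonClass A] in
theorem retTerm_cons_succ (π : Policy S A) (x : S × A) (τ : ℕ → S × A) (i : ℕ) :
    M.retTerm π (i + 1) (cons x τ) = M.γ * M.retTerm π i τ := by
  rw [retTerm, retTerm, pow_succ' M.γ (i + 1), mul_assoc]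
  rfl

omit [Fintype A] [MeasurableSingletonClass A] in
-- The Bellman recursion along a single path. Summability is what permits splitting off the first
-- term: a divergent `tsum` is 0 by convention.
theorem ret_cons (π : Policy S A) (x : S × A) (τ : ℕ → S × A)
    (hτ : Summable fun i => M.retTerm π i τ) :
    M.ret π (cons x τ) =
      M.reward x.1 x.2 (τ 0).1 + M.γ * (M.ret π τ - M.α * π.logProb (τ 0)) := by
  have hs : Summable fun i => M.retTerm π (i + 1) (cons x τ) := by
    simp_rw [retTerm_cons_succ]
    exact hτ.mul_left _
  have hs' : Summable fun i => M.retTerm π i (cons x τ) :=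
    (summable_nat_add_iff (f := fun i => M.retTerm π i (cons x τ)) 1).1 hs
  have h2 : ∑' i, M.retTerm π i (cons x τ) =
      M.retTerm π 0 (cons x τ) + ∑' i, M.retTerm π (i + 1) (cons x τ) :=
    hs'.tsum_eq_zero_add
  simp_rw [retTerm_cons_zero, retTerm_cons_succ, tsum_mul_left] at h2
  rw [ret_eq M π (cons x τ), h2, ret_eq M π τ]
  simp only [cons_zero, cons_succ]
  change M.reward x.1 x.2 (τ 0).1 + _ = _
  ring

variable {M} {R : ℝ} (hR : ∀ s a s', |M.reward s a s'| ≤ R)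

/-- A bound on the expected absolute value of the part of the return after the first reward. -/
noncomputable def tailBound (M : DecisionProcess S A) (R : ℝ) : ℝ≥0∞ :=
  (∑' i : ℕ, ENNReal.ofReal M.γ ^ (i + 1)) *
    (ENNReal.ofReal R + ENNReal.ofReal M.α * Fintype.card A)

omit [MeasurableSingletonClass A] in
theorem tailBound_ne_top (M : DecisionProcess S A) (R : ℝ) : M.tailBound R ≠ ∞ := by
  refine ENNReal.mul_ne_top ?_ (by finiteness)
  rw [ENNReal.tsum_geometric_add_one]
  have : ENNReal.ofReal M.γ < 1 := by
    rw [← ENNReal.ofReal_one]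
    exact (ENNReal.ofReal_lt_ofReal_iff one_pos).2 M.γ_lt_one
  refine ENNReal.mul_ne_top ENNReal.ofReal_ne_top (ENNReal.inv_ne_top.2 ?_)
  exact (tsub_pos_of_lt this).ne'

theorem lintegral_step_logProb_le (π : Policy S A) (x : S × A) :
    ∫⁻ y, ‖π.logProb y‖ₑ ∂(M.step π x) ≤ Fintype.card A := by
  rw [M.lintegral_step π x π.measurable_logProb.enorm]
  calc _ ≤ ∫⁻ _, (Fintype.card A : ℝ≥0∞) ∂(M.transition.1 x) :=
        lintegral_mono fun s => π.lintegral_logProb_le s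
    _ = Fintype.card A := by simp

include hR

theorem lintegral_tsum_retTerm_le (π : Policy S A) (x : S × A) :
    ∫⁻ τ, ∑' i, ‖M.retTerm π i τ‖ₑ ∂(M.trajectory π x) ≤ M.tailBound R := by
  rw [lintegral_tsum fun i => (M.measurable_retTerm π i).enorm.aemeasurable, tailBound,
    ← ENNReal.tsum_mul_right]
  refine ENNReal.tsum_le_tsum fun i => ?_
  have hlog : Measurable fun τ : ℕ → S × A => ‖π.logProb (τ (i + 1))‖ₑ :=
    (π.measurable_logProb.comp (measurable_pi_apply (i + 1))).enorm
  have h : ∀ τ, ‖M.retTerm π i τ‖ₑ ≤ ENNReal.ofReal M.γ ^ (i + 1) *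
      (ENNReal.ofReal R + ENNReal.ofReal M.α * ‖π.logProb (τ (i + 1))‖ₑ) := by
    intro τ
    rw [retTerm, enorm_mul, enorm_pow, Real.enorm_of_nonneg M.γ_pos.le]
    gcongr
    refine (enorm_sub_le).trans ?_
    gcongr
    · rw [← ofReal_norm]
      exact ENNReal.ofReal_le_ofReal (hR _ _ _)
    · rw [enorm_mul, Real.enorm_of_nonneg M.α_pos.le]
  refine (lintegral_mono h).trans ?_
  have hsum : Measurable fun τ : ℕ → S × A =>
      ENNReal.ofReal R + ENNReal.ofReal M.α * ‖π.logProb (τ (i + 1))‖ₑ :=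
    measurable_const.add (hlog.const_mul _)
  rw [lintegral_const_mul _ hsum, lintegral_add_left measurable_const, lintegral_const_mul _ hlog, lintegral_const,
    measure_univ, mul_one]
  gcongr
  exact lintegral_chain_eval_succ_le (M.step π) π.measurable_logProb.enorm
    (fun x => lintegral_step_logProb_le π x) i x

theorem ae_summable_retTerm (π : Policy S A) (x : S × A) :
    ∀ᵐ τ ∂(M.trajectory π x), Summable fun i => M.retTerm π i τ := by
  have h := (lintegral_tsum_retTerm_le hR π x).trans_lt (tailBound_ne_top M R).lt_top
  filter_upwards [ae_lt_top (Measurable.tsum fun i => (M.measurable_retTerm π i).enorm)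
    h.ne] with τ hτ
  have := ENNReal.summable_toReal hτ.ne
  rw [← summable_norm_iff]
  simpa using this

theorem lintegral_ret_le (π : Policy S A) (x : S × A) :
    ∫⁻ τ, ‖M.ret π τ‖ₑ ∂(M.trajectory π x) ≤ ENNReal.ofReal R + M.tailBound R := by
  have h : ∀ τ, ‖M.ret π τ‖ₑ ≤ ENNReal.ofReal R + ∑' i, ‖M.retTerm π i τ‖ₑ := by
    intro τ
    rw [ret_eq]
    refine (enorm_add_le _ _).trans ?_
    gcongr
    · rw [← ofReal_norm]
      exact ENNReal.ofReal_le_ofReal (hR _ _ _)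
    · exact enorm_tsum_le_tsum_enorm
  refine (lintegral_mono h).trans ?_
  rw [lintegral_add_left measurable_const, lintegral_const, measure_univ, mul_one]
  gcongr
  exact lintegral_tsum_retTerm_le hR π x

omit hR

/-- The return law as a kernel. -/
noncomputable def returnKernel (M : DecisionProcess S A) (π : Policy S A) : ReturnDist S A :=
  ⟨(M.trajectory π).map (M.ret π), Kernel.IsMarkovKernel.map _ (M.measurable_ret π)⟩

theorem returnKernel_apply (π : Policy S A) (x : S × A) :
    (M.returnKernel π).1 x = M.returnLaw π x.1 x.2 :=
  Kernel.map_apply _ (M.measurable_ret π) _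

theorem lintegral_returnKernel (π : Policy S A) (x : S × A) {f : ℝ → ℝ≥0∞} (hf : Measurable f) :
    ∫⁻ z, f z ∂((M.returnKernel π).1 x) = ∫⁻ τ, f (M.ret π τ) ∂(M.trajectory π x) :=
  Kernel.lintegral_map _ (M.measurable_ret π) _ hf

theorem lintegral_returnKernel_le (hR : ∀ s a s', |M.reward s a s'| ≤ R) (π : Policy S A)
    (x : S × A) :
    ∫⁻ z, ‖z‖ₑ ∂((M.returnKernel π).1 x) ≤ ENNReal.ofReal R + M.tailBound R := by
  rw [lintegral_returnKernel π x measurable_enorm]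
  exact lintegral_ret_le hR π x

theorem measurable_bellmanMap (M : DecisionProcess S A) (π : Policy S A) :
    Measurable fun w : (S × A) × (S × A) × ℝ =>
      M.reward w.1.1 w.1.2 w.2.1.1 + M.γ * (w.2.2 - M.α * π.logProb w.2.1) :=
  (M.measurable_reward_comp measurable_fst (measurable_fst.comp measurable_snd)).add
    (((measurable_snd.comp measurable_snd).sub ((π.measurable_logProb.comp
      (measurable_fst.comp measurable_snd)).const_mul _)).const_mul _)

/-- The distributional Bellman operator as a map of kernels. -/
noncomputable def bellmanKernel (M : DecisionProcess S A) (π : Policy S A) (Z : ReturnDist S A) :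
    ReturnDist S A :=
  ⟨(Kernel.id ×ₖ (M.step π ⊗ₖ Kernel.prodMkLeft (S × A) Z.1)).map
    fun w : (S × A) × (S × A) × ℝ =>
      M.reward w.1.1 w.1.2 w.2.1.1 + M.γ * (w.2.2 - M.α * π.logProb w.2.1),
    Kernel.IsMarkovKernel.map _ (M.measurable_bellmanMap π)⟩

theorem lintegral_bellman (π : Policy S A) (Z : ReturnDist S A) (x : S × A) {f : ℝ → ℝ≥0∞}
    (hf : Measurable f) :
    ∫⁻ z, f z ∂(M.bellman π Z x) = ∫⁻ y, ∫⁻ z,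
      f (M.reward x.1 x.2 y.1 + M.γ * (z - M.α * π.logProb y)) ∂(Z.1 y) ∂(M.step π x) := by
  have hm : Measurable fun y : (S × A) × ℝ =>
      M.reward x.1 x.2 y.1.1 + M.γ * (y.2 - M.α * Real.log (π.prob y.1.1 y.1.2)) :=
    (M.measurable_bellmanMap π).comp measurable_prodMk_left
  have hfm : Measurable fun y : (S × A) × ℝ =>
      f (M.reward x.1 x.2 y.1.1 + M.γ * (y.2 - M.α * Real.log (π.prob y.1.1 y.1.2))) := hf.comp hm
  rw [bellman, lintegral_map hf hm, Measure.lintegral_compProd hfm]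
  rfl

theorem bellmanKernel_apply (π : Policy S A) (Z : ReturnDist S A) (x : S × A) :
    (M.bellmanKernel π Z).1 x = M.bellman π Z x := by
  refine Measure.ext_of_lintegral _ fun f hf => ?_
  have hm : Measurable fun w : (S × A) × (S × A) × ℝ =>
      f (M.reward w.1.1 w.1.2 w.2.1.1 + M.γ * (w.2.2 - M.α * π.logProb w.2.1)) :=
    hf.comp (M.measurable_bellmanMap π)
  have hm' : Measurable fun w : (S × A) × ℝ =>
      f (M.reward x.1 x.2 w.1.1 + M.γ * (w.2 - M.α * π.logProb w.1)) :=
    hm.comp measurable_prodMk_left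
  rw [lintegral_bellman π Z x hf, bellmanKernel, Kernel.lintegral_map _ (M.measurable_bellmanMap π)
    _ hf, Kernel.lintegral_id_prod hm, Kernel.lintegral_compProd _ _ _ hm']
  rfl

instance (π : Policy S A) (Z : ReturnDist S A) (x : S × A) :
    IsProbabilityMeasure (M.bellman π Z x) := by
  rw [← bellmanKernel_apply]; infer_instance

/-- The return law is a fixed point of the distributional Bellman operator. -/
theorem bellman_returnKernel (hR : ∀ s a s', |M.reward s a s'| ≤ R) (π : Policy S A) (x : S × A) :
    M.bellman π (M.returnKernel π) x = (M.returnKernel π).1 x := by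
  refine Measure.ext_of_lintegral _ fun f hf => ?_
  have hfr : Measurable fun τ => f (M.ret π τ) := hf.comp (M.measurable_ret π)
  rw [lintegral_bellman π _ x hf, lintegral_returnKernel π x hf, trajectory_eq_chain,
    lintegral_chain _ _ hfr]
  refine lintegral_congr fun y => ?_
  have hm : Measurable fun z : ℝ =>
      M.reward x.1 x.2 y.1 + M.γ * (z - M.α * π.logProb y) := by fun_prop
  have hfm : Measurable fun z : ℝ =>
      f (M.reward x.1 x.2 y.1 + M.γ * (z - M.α * π.logProb y)) := hf.comp hm
  have hfmr : Measurable fun τ => f (M.reward x.1 x.2 y.1 + M.γ * (M.ret π τ - M.α * π.logProb y)) :=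
    hfm.comp (M.measurable_ret π)
  rw [lintegral_returnKernel π y hfm]
  have h1 : ∫⁻ τ, f (M.ret π (cons x τ)) ∂(chain (M.step π) y) =
      ∫⁻ τ, f (M.reward x.1 x.2 (τ 0).1 + M.γ * (M.ret π τ - M.α * π.logProb (τ 0)))
        ∂(chain (M.step π) y) := by
    refine lintegral_congr_ae ?_
    filter_upwards [ae_summable_retTerm hR π y] with τ hτ
    rw [ret_cons M π x τ hτ]
  have hm2 : Measurable fun τ : ℕ → S × A =>
      f (M.reward x.1 x.2 (τ 0).1 + M.γ * (M.ret π τ - M.α * π.logProb (τ 0))) :=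
    hf.comp ((M.measurable_reward_comp measurable_const (measurable_pi_apply _)).add
      (((M.measurable_ret π).sub
        ((π.measurable_logProb.comp (measurable_pi_apply _)).const_mul _)).const_mul _))
  -- The two integrands differ only in having `τ 0` in place of `y`, and the chain from `y` has `τ 0
  -- = y` almost surely. Overwriting the first coordinate by `y` on both sides makes them agree.
  rw [trajectory_eq_chain, h1, ← lintegral_chain_cons_tail _ _ hm2,
    ← lintegral_chain_cons_tail _ _ hfmr]
  rfl

end DecisionProcess

namespace DecisionProcess

variable {S A : Type*} [MeasurableSpace S] [MeasurableSpace A] {M : DecisionProcess S A}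
  [Fintype A] [MeasurableSingletonClass A]

/-! ## Convergence of distributional policy evaluation -/

theorem integrable_bellman_comp (π : Policy S A) (Z : ReturnDist S A) (x : S × A) {f : ℝ → ℝ}
    (hf : Integrable f (M.bellman π Z x)) (hfm : Measurable f) :
    Integrable (fun y : (S × A) × ℝ =>
      f (M.reward x.1 x.2 y.1.1 + M.γ * (y.2 - M.α * π.logProb y.1)))
      ((M.step π x).compProd Z.1) := by
  have hm : Measurable fun y : (S × A) × ℝ =>
      M.reward x.1 x.2 y.1.1 + M.γ * (y.2 - M.α * π.logProb y.1) :=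
    (M.measurable_bellmanMap π).comp measurable_prodMk_left
  exact (integrable_map_measure hfm.aestronglyMeasurable hm.aemeasurable).1 hf

theorem integral_bellman (π : Policy S A) (Z : ReturnDist S A) (x : S × A) {f : ℝ → ℝ}
    (hf : Integrable f (M.bellman π Z x)) (hfm : Measurable f) :
    ∫ z, f z ∂(M.bellman π Z x) = ∫ y, ∫ z,
      f (M.reward x.1 x.2 y.1 + M.γ * (z - M.α * π.logProb y)) ∂(Z.1 y) ∂(M.step π x) := by
  have hm : Measurable fun y : (S × A) × ℝ =>
      M.reward x.1 x.2 y.1.1 + M.γ * (y.2 - M.α * π.logProb y.1) :=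
    (M.measurable_bellmanMap π).comp measurable_prodMk_left
  rw [← Measure.integral_compProd (integrable_bellman_comp π Z x hf hfm)]
  exact integral_map hm.aemeasurable hfm.aestronglyMeasurable

/-- Both integrals lie within L times a first moment of `f 0`. The bound `B` serves only for
integrability and does not enter the estimate. -/
theorem abs_integral_sub_integral_le {m m' : Measure ℝ} [IsProbabilityMeasure m]
    [IsProbabilityMeasure m'] {C : ℝ≥0} (hm : ∫⁻ z, ‖z‖ₑ ∂m ≤ C) (hm' : ∫⁻ z, ‖z‖ₑ ∂m' ≤ C)
    {f : ℝ → ℝ} (hf : Measurable f) {B L : ℝ} (hB : ∀ z, |f z| ≤ B)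
    (hL : ∀ z z', |f z - f z'| ≤ L * |z - z'|) :
    |∫ z, f z ∂m - ∫ z, f z ∂m'| ≤ L * (2 * C) := by
  have hL0 : 0 ≤ L := by simpa using (abs_nonneg _).trans (hL 1 0)
  have key : ∀ (n : Measure ℝ) [IsProbabilityMeasure n], ∫⁻ z, ‖z‖ₑ ∂n ≤ C →
      |∫ z, f z ∂n - f 0| ≤ L * C := by
    intro n _ hn
    have hi : Integrable f n := .of_bound hf.aestronglyMeasurable B (.of_forall hB)
    have hid : Integrable (fun z : ℝ => z) n :=
      ⟨measurable_id.aestronglyMeasurable, hn.trans_lt ENNReal.coe_lt_top⟩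
    have h1 : ∫ z, f z ∂n - f 0 = ∫ z, (f z - f 0) ∂n := by
      rw [integral_sub hi (integrable_const _)]; simp
    have h2 : ∫ z, ‖z‖ ∂n ≤ C := by
      rw [integral_norm_eq_lintegral_enorm hid.1]
      exact ENNReal.toReal_le_coe_of_le_coe hn
    calc |∫ z, f z ∂n - f 0| ≤ ∫ z, |f z - f 0| ∂n := by
          rw [h1]; exact abs_integral_le_integral_abs
      _ ≤ ∫ z, L * ‖z‖ ∂n := by
          refine integral_mono (hi.sub (integrable_const _)).abs (hid.norm.const_mul _) fun z => ?_
          simpa using hL z 0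
      _ = L * ∫ z, ‖z‖ ∂n := integral_const_mul _ _
      _ ≤ L * C := by gcongr
  have h1 := abs_le.1 (key m hm)
  have h2 := abs_le.1 (key m' hm')
  rw [abs_le]
  constructor <;> linarith

/-- Iterates of the distributional Bellman operator contract geometrically against bounded
Lipschitz test functions. -/
theorem abs_integral_iterate_sub_le (π : Policy S A) {Z Z' : ReturnDist S A} {C : ℝ≥0}
    (hZ : ∀ x, ∫⁻ z, ‖z‖ₑ ∂(Z.1 x) ≤ C) (hZ' : ∀ x, ∫⁻ z, ‖z‖ₑ ∂(Z'.1 x) ≤ C) (i : ℕ) (x : S × A)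
    {f : ℝ → ℝ} (hf : Measurable f) {B L : ℝ} (hB : ∀ z, |f z| ≤ B)
    (hL : ∀ z z', |f z - f z'| ≤ L * |z - z'|) :
    |∫ z, f z ∂(((M.bellmanKernel π)^[i] Z).1 x) - ∫ z, f z ∂(((M.bellmanKernel π)^[i] Z').1 x)|
      ≤ L * M.γ ^ i * (2 * C) := by
  induction i generalizing x f L with
  | zero => simpa using abs_integral_sub_integral_le (hZ x) (hZ' x) hf hB hL
  | succ i ih =>
    simp only [Function.iterate_succ_apply']
    set W := (M.bellmanKernel π)^[i] Z
    set W' := (M.bellmanKernel π)^[i] Z'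
    have hbd : ∀ (V : ReturnDist S A), Integrable f (M.bellman π V x) := fun V =>
      .of_bound hf.aestronglyMeasurable B (.of_forall hB)
    have hint : ∀ V : ReturnDist S A, Integrable (fun y => ∫ z,
        f (M.reward x.1 x.2 y.1 + M.γ * (z - M.α * π.logProb y)) ∂(V.1 y)) (M.step π x) := fun V =>
      (integrable_bellman_comp π V x (hbd V) hf).integral_compProd
    rw [bellmanKernel_apply, bellmanKernel_apply, integral_bellman π W x (hbd W) hf,
      integral_bellman π W' x (hbd W') hf, ← integral_sub (hint W) (hint W')]
    have hγ := M.γ_pos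
    have h : ∀ y, ‖(∫ z, f (M.reward x.1 x.2 y.1 + M.γ * (z - M.α * π.logProb y)) ∂(W.1 y)) -
        ∫ z, f (M.reward x.1 x.2 y.1 + M.γ * (z - M.α * π.logProb y)) ∂(W'.1 y)‖
        ≤ L * M.γ ^ (i + 1) * (2 * C) := by
      intro y
      have hm : Measurable fun z : ℝ => M.reward x.1 x.2 y.1 + M.γ * (z - M.α * π.logProb y) := by
        fun_prop
      -- The new test function is `f` after an affine map of slope γ: same bound `B`, Lipschitz
      -- constant `L * γ`. The unbounded logarithm is only a translation.
      have := ih y (f := fun z => f (M.reward x.1 x.2 y.1 + M.γ * (z - M.α * π.logProb y)))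
        (hf.comp hm) (L := L * M.γ) (fun z => hB _) (by
          intro z z'
          refine (hL _ _).trans_eq ?_
          rw [mul_assoc, ← abs_of_pos hγ, ← abs_mul, abs_of_pos hγ]
          congr 2
          ring)
      calc _ ≤ L * M.γ * M.γ ^ i * (2 * C) := this
        _ = _ := by ring
    simpa using norm_integral_le_of_norm_le_const (μ := M.step π x) (.of_forall h)

theorem iterate_bellmanKernel_returnKernel {R : ℝ} (hR : ∀ s a s', |M.reward s a s'| ≤ R)
    (π : Policy S A) (i : ℕ) :
    (M.bellmanKernel π)^[i] (M.returnKernel π) = M.returnKernel π := by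
  refine Function.iterate_fixed ?_ i
  refine Subtype.ext (Kernel.ext fun x => ?_)
  rw [bellmanKernel_apply, bellman_returnKernel hR]

/-- Distributional policy evaluation converges weakly to the return law. -/
theorem weaklyConverges_iterate {R : ℝ} (hR : ∀ s a s', |M.reward s a s'| ≤ R) (π : Policy S A)
    {Z : ReturnDist S A} {C : ℝ≥0} (hZ : ∀ x, ∫⁻ z, ‖z‖ₑ ∂(Z.1 x) ≤ C) (x : S × A) :
    WeaklyConverges (fun i => ((M.bellmanKernel π)^[i] Z).1 x) (M.returnLaw π x.1 x.2) := by
  rw [← returnKernel_apply]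
  set K : ℝ≥0∞ := ENNReal.ofReal R + M.tailBound R
  have hK : K ≠ ∞ := by
    have := tailBound_ne_top M R
    finiteness
  set C' : ℝ≥0 := max C K.toNNReal
  have hZC : ∀ x, ∫⁻ z, ‖z‖ₑ ∂(Z.1 x) ≤ C' := fun x =>
    (hZ x).trans (ENNReal.coe_le_coe.2 (le_max_left _ _))
  have hRC : ∀ x, ∫⁻ z, ‖z‖ₑ ∂((M.returnKernel π).1 x) ≤ C' := fun x =>
    (lintegral_returnKernel_le hR π x).trans
      ((ENNReal.coe_toNNReal hK).symm.le.trans (ENNReal.coe_le_coe.2 (le_max_right _ _)))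
  let μs : ℕ → ProbabilityMeasure ℝ := fun i => ⟨((M.bellmanKernel π)^[i] Z).1 x, inferInstance⟩
  let μ : ProbabilityMeasure ℝ := ⟨(M.returnKernel π).1 x, inferInstance⟩
  have h : Filter.Tendsto μs Filter.atTop (nhds μ) := by
    -- Bounded Lipschitz functions determine weak convergence. The limit is compared with itself as
    -- a constant sequence of iterates, being a fixed point.
    rw [tendsto_iff_forall_lipschitz_integral_tendsto]
    rintro f ⟨B, hB⟩ ⟨L, hL⟩
    have hbd : ∀ z, |f z| ≤ B + |f 0| := by
      intro z
      have := hB z 0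
      rw [Real.dist_eq] at this
      have h2 := abs_add_le (f z - f 0) (f 0)
      rw [sub_add_cancel] at h2
      linarith
    have hlip : ∀ z z', |f z - f z'| ≤ (L : ℝ) * |z - z'| := by
      intro z z'
      simpa [Real.dist_eq] using hL.dist_le_mul z z'
    rw [tendsto_iff_dist_tendsto_zero]
    refine squeeze_zero (fun _ => dist_nonneg) (g := fun i => L * M.γ ^ i * (2 * C')) (fun i => ?_) ?_
    · have := abs_integral_iterate_sub_le (M := M) π hZC hRC i x hL.continuous.measurable hbd hlip
      rw [iterate_bellmanKernel_returnKernel hR] at this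
      exact this
    · have := ((tendsto_pow_atTop_nhds_zero_of_lt_one M.γ_pos.le M.γ_lt_one).const_mul
        (L : ℝ)).mul_const (2 * (C' : ℝ))
      simpa using this
  exact ProbabilityMeasure.tendsto_iff_forall_integral_tendsto.1 h

/-! ## The mean return -/

theorem integrable_returnKernel {R : ℝ} (hR : ∀ s a s', |M.reward s a s'| ≤ R) (π : Policy S A)
    (x : S × A) : Integrable (fun z : ℝ => z) ((M.returnKernel π).1 x) := by
  refine ⟨measurable_id.aestronglyMeasurable, (lintegral_returnKernel_le hR π x).trans_lt ?_⟩
  have := tailBound_ne_top M R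
  finiteness

theorem integral_returnKernel (π : Policy S A) (x : S × A) :
    ∫ z, z ∂((M.returnKernel π).1 x) = M.Q π x.1 x.2 := by
  rw [returnKernel_apply, returnLaw, integral_map (M.measurable_ret π).aemeasurable
    measurable_id'.aestronglyMeasurable]
  rfl

omit [Fintype A] [MeasurableSingletonClass A] in
theorem measurable_integral_returnDist (Z : ReturnDist S A) :
    Measurable fun x => ∫ z, z ∂(Z.1 x) :=
  (measurable_id'.stronglyMeasurable.integral_kernel (κ := Z.1)).measurable

theorem measurable_Q (π : Policy S A) : Measurable fun x : S × A => M.Q π x.1 x.2 := by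
  simp_rw [← integral_returnKernel]
  exact measurable_integral_returnDist _

theorem abs_Q_le {R : ℝ} (hR : ∀ s a s', |M.reward s a s'| ≤ R) (π : Policy S A) (x : S × A) :
    |M.Q π x.1 x.2| ≤ (ENNReal.ofReal R + M.tailBound R).toReal := by
  rw [← integral_returnKernel, ← Real.norm_eq_abs]
  refine (norm_integral_le_lintegral_norm _).trans ?_
  refine ENNReal.toReal_mono ?_ ?_
  · have := tailBound_ne_top M R
    finiteness
  · simp_rw [ofReal_norm]
    exact lintegral_returnKernel_le hR π x

/-- The entropy-regularised value of `π` at `s` for the action values `q`. -/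
noncomputable def polValue (M : DecisionProcess S A) (π : Policy S A) (q : S × A → ℝ) (s : S) : ℝ :=
  ∑ a, π.prob s a * (q (s, a) - M.α * π.logProb (s, a))

/-- The expected value of reward plus discounted next value. -/
noncomputable def backup (M : DecisionProcess S A) (v : S → ℝ) (x : S × A) : ℝ :=
  ∫ s, (M.reward x.1 x.2 s + M.γ * v s) ∂(M.transition.1 x)

/-- The Bellman equation for the mean return. -/
theorem Q_eq_backup {R : ℝ} (hR : ∀ s a s', |M.reward s a s'| ≤ R) (π : Policy S A) (x : S × A) :
    M.Q π x.1 x.2 = M.backup (M.polValue π fun y => M.Q π y.1 y.2) x := by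
  have hi := integrable_returnKernel hR π x
  rw [← bellman_returnKernel hR] at hi
  have hc : Integrable (fun y : S × A => ∫ z, (M.reward x.1 x.2 y.1 +
      M.γ * (z - M.α * π.logProb y)) ∂((M.returnKernel π).1 y)) (M.step π x) :=
    (integrable_bellman_comp π _ x hi measurable_id').integral_compProd
  have e : ∀ y : S × A, ∫ z, (M.reward x.1 x.2 y.1 + M.γ * (z - M.α * π.logProb y))
      ∂((M.returnKernel π).1 y) =
      M.reward x.1 x.2 y.1 + M.γ * (M.Q π y.1 y.2 - M.α * π.logProb y) := by
    intro y
    have hy := integrable_returnKernel hR π y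
    have hy' : Integrable (fun z => M.γ * (z - M.α * π.logProb y)) ((M.returnKernel π).1 y) :=
      (hy.sub (integrable_const _)).const_mul _
    rw [integral_add (integrable_const _) hy', integral_const_mul, integral_sub hy (integrable_const _), integral_returnKernel]
    simp
  rw [← integral_returnKernel, ← bellman_returnKernel hR, integral_bellman π _ x hi measurable_id']
  simp_rw [e] at hc ⊢
  unfold step at hc ⊢
  rw [ProbabilityTheory.integral_compProd hc, backup]
  refine integral_congr_ae (.of_forall fun s => ?_)
  simp only [Kernel.prodMkLeft_apply]
  rw [Policy.integral_eq, polValue, Finset.mul_sum]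
  simp_rw [mul_add]
  rw [Finset.sum_add_distrib, ← Finset.sum_mul, π.sum_prob, one_mul]
  congr 1
  exact Finset.sum_congr rfl fun a _ => by ring

end DecisionProcess

/-! ## Soft maximum and soft-greedy policies -/

/-- Bounded measurable real functions. -/
structure BddMeas {X : Type*} [MeasurableSpace X] (f : X → ℝ) : Prop where
  measurable : Measurable f
  bounded : ∃ B, ∀ x, |f x| ≤ B

theorem BddMeas.integrable {X : Type*} [MeasurableSpace X] {f : X → ℝ} (hf : BddMeas f)
    (m : Measure X) [IsFiniteMeasure m] : Integrable f m := by
  obtain ⟨B, hB⟩ := hf.bounded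
  exact .of_bound hf.measurable.aestronglyMeasurable B (.of_forall hB)

section Soft

variable {S A : Type*} [Fintype A]

/-- The soft maximum `α log ∑ exp (q(s, a) / α)` of action values. -/
noncomputable def softValue (α : ℝ) (q : S × A → ℝ) (s : S) : ℝ :=
  α * Real.log (∑ a, Real.exp (q (s, a) / α))

/-- The softmax weights of action values at temperature `α`. -/
noncomputable def softProb (α : ℝ) (q : S × A → ℝ) (s : S) (a : A) : ℝ :=
  Real.exp (q (s, a) / α) / ∑ b, Real.exp (q (s, b) / α)

variable [Nonempty A]

theorem sum_exp_pos (α : ℝ) (q : S × A → ℝ) (s : S) : 0 < ∑ b, Real.exp (q (s, b) / α) :=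
  Finset.sum_pos (fun _ _ => Real.exp_pos _) Finset.univ_nonempty

theorem softProb_pos (α : ℝ) (q : S × A → ℝ) (s : S) (a : A) : 0 < softProb α q s a :=
  div_pos (Real.exp_pos _) (sum_exp_pos α q s)

theorem sum_softProb (α : ℝ) (q : S × A → ℝ) (s : S) : ∑ a, softProb α q s a = 1 := by
  simp_rw [softProb, ← Finset.sum_div]
  exact div_self (sum_exp_pos α q s).ne'

omit [Nonempty A] in
theorem softProb_congr {α : ℝ} {q q' : S × A → ℝ} {s : S} (h : ∀ a, q (s, a) = q' (s, a)) :
    softProb α q s = softProb α q' s := by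
  funext a
  simp [softProb, h]

theorem log_softProb (α : ℝ) (q : S × A → ℝ) (s : S) (a : A) :
    Real.log (softProb α q s a) = q (s, a) / α - Real.log (∑ b, Real.exp (q (s, b) / α)) := by
  rw [softProb, Real.log_div (Real.exp_pos _).ne' (sum_exp_pos α q s).ne', Real.log_exp]

/-- The soft maximum is monotone and commutes with adding constants. Used in both directions, this
makes it nonexpansive in the supremum norm. -/
theorem softValue_le_add {α : ℝ} (hα : 0 < α) {q q' : S × A → ℝ} {s : S} {c : ℝ}
    (h : ∀ a, q (s, a) ≤ q' (s, a) + c) : softValue α q s ≤ softValue α q' s + c := by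
  have h1 : ∑ a, Real.exp (q (s, a) / α) ≤ (∑ a, Real.exp (q' (s, a) / α)) * Real.exp (c / α) := by
    rw [Finset.sum_mul]
    refine Finset.sum_le_sum fun a _ => ?_
    rw [← Real.exp_add, ← add_div]
    have := h a
    gcongr
  have h2 := Real.log_le_log (sum_exp_pos α q s) h1
  rw [Real.log_mul (sum_exp_pos α q' s).ne' (Real.exp_pos _).ne', Real.log_exp] at h2
  calc softValue α q s ≤ α * (Real.log (∑ a, Real.exp (q' (s, a) / α)) + c / α) := by
        unfold softValue; gcongr
    _ = _ := by rw [softValue, mul_add, mul_div_cancel₀ _ hα.ne']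

theorem abs_softValue_le {α : ℝ} (hα : 0 < α) {q : S × A → ℝ} {s : S} {B : ℝ}
    (h : ∀ a, |q (s, a)| ≤ B) : |softValue α q s| ≤ B + |α * Real.log (Fintype.card A)| := by
  have e : softValue α (0 : S × A → ℝ) s = α * Real.log (Fintype.card A) := by
    simp [softValue]
  have h1 := softValue_le_add hα (q := q) (q' := 0) (s := s) (c := B)
    fun a => by simpa using (abs_le.1 (h a)).2
  have h2 := softValue_le_add hα (q := 0) (q' := q) (s := s) (c := B)
    fun a => by have := (abs_le.1 (h a)).1; simp only [Pi.zero_apply]; linarith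
  rw [e] at h1 h2
  have h3 := le_abs_self (α * Real.log (Fintype.card A))
  have h4 := neg_abs_le (α * Real.log (Fintype.card A))
  rw [abs_le]
  constructor <;> linarith

theorem tendsto_softProb {α : ℝ} {q : ℕ → S × A → ℝ} {q' : S × A → ℝ} {s : S}
    (h : ∀ a, Filter.Tendsto (fun k => q k (s, a)) Filter.atTop (nhds (q' (s, a)))) (a : A) :
    Filter.Tendsto (fun k => softProb α (q k) s a) Filter.atTop (nhds (softProb α q' s a)) := by
  have h1 : ∀ b, Filter.Tendsto (fun k => Real.exp (q k (s, b) / α)) Filter.atTop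
      (nhds (Real.exp (q' (s, b) / α))) := fun b =>
    (Real.continuous_exp.tendsto _).comp ((h b).div_const α)
  exact (h1 a).div (tendsto_finsetSum _ fun b _ => h1 b) (sum_exp_pos α q' s).ne'

variable [MeasurableSpace S] [MeasurableSpace A]

omit [Nonempty A] in
theorem measurable_softValue {α : ℝ} {q : S × A → ℝ} (hq : Measurable q) :
    Measurable (softValue α q) :=
  (Real.measurable_log.comp (Finset.measurable_sum _ fun _ _ =>
    Real.measurable_exp.comp ((hq.comp measurable_prodMk_right).div_const α))).const_mul α

omit [Nonempty A] in
theorem measurable_softProb {α : ℝ} {q : S × A → ℝ} (hq : Measurable q) (a : A) :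
    Measurable fun s => softProb α q s a :=
  (Real.measurable_exp.comp ((hq.comp measurable_prodMk_right).div_const α)).div
    (Finset.measurable_sum _ fun _ _ =>
      Real.measurable_exp.comp ((hq.comp measurable_prodMk_right).div_const α))

theorem BddMeas.softValue {α : ℝ} (hα : 0 < α) {q : S × A → ℝ} (hq : BddMeas q) :
    BddMeas (softValue α q) :=
  ⟨measurable_softValue hq.measurable, hq.bounded.imp' (fun B => B + |α * Real.log (Fintype.card A)|)
    fun _ hB _ => abs_softValue_le hα fun _ => hB _⟩

/-- The policy with softmax weights. -/
noncomputable def softPolicy (α : ℝ) (q : S × A → ℝ) (hq : Measurable q) : Policy S A :=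
  ⟨{ toFun := fun s => ∑ a, ENNReal.ofReal (softProb α q s a) • Measure.dirac a
     measurable' := by
      refine Measure.measurable_of_measurable_coe _ fun t _ => ?_
      simp only [Measure.coe_finsetSum, Finset.sum_apply, Measure.smul_apply, smul_eq_mul]
      exact Finset.measurable_sum _ fun a _ =>
        (measurable_softProb hq a).ennreal_ofReal.mul_const _ },
    ⟨fun s => ⟨by
      simp only [Kernel.coe_mk, Measure.coe_finsetSum, Finset.sum_apply, Measure.smul_apply,
        smul_eq_mul, measure_univ, mul_one]
      rw [← ENNReal.ofReal_sum_of_nonneg fun a _ => (softProb_pos α q s a).le, sum_softProb,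
        ENNReal.ofReal_one]⟩⟩⟩

theorem softPolicy_prob [MeasurableSingletonClass A] (α : ℝ) (q : S × A → ℝ) (hq : Measurable q)
    (s : S) (a : A) : (softPolicy α q hq).prob s a = softProb α q s a := by
  classical
  have : (softPolicy α q hq).1 s {a} = ENNReal.ofReal (softProb α q s a) := by
    simp [softPolicy, Set.indicator_apply]
  rw [Policy.prob, Measure.real, this, ENNReal.toReal_ofReal (softProb_pos α q s a).le]

end Soft

/-! ### Entropy-regularised values and Gibbs' principle -/

namespace DecisionProcess

variable {S A : Type*} [MeasurableSpace S] [MeasurableSpace A] (M : DecisionProcess S A)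
  [Fintype A]

theorem polValue_le_add (π : Policy S A) [MeasurableSingletonClass A] {q q' : S × A → ℝ} {s : S}
    {c : ℝ} (h : ∀ a, q (s, a) ≤ q' (s, a) + c) :
    M.polValue π q s ≤ M.polValue π q' s + c := by
  calc M.polValue π q s
      ≤ ∑ a, (π.prob s a * (q' (s, a) - M.α * π.logProb (s, a)) + π.prob s a * c) := by
        refine Finset.sum_le_sum fun a _ => ?_
        rw [← mul_add]
        refine mul_le_mul_of_nonneg_left ?_ (π.prob_nonneg s a)
        linarith [h a]
    _ = M.polValue π q' s + c := by
        rw [Finset.sum_add_distrib, ← Finset.sum_mul, π.sum_prob, one_mul]; rfl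

theorem abs_polValue_le (π : Policy S A) [MeasurableSingletonClass A] {q : S × A → ℝ} {s : S}
    {B : ℝ} (h : ∀ a, 0 < π.prob s a → |q (s, a)| ≤ B) :
    |M.polValue π q s| ≤ B + M.α * Fintype.card A := by
  calc |M.polValue π q s| ≤ ∑ a, |π.prob s a * (q (s, a) - M.α * π.logProb (s, a))| :=
        Finset.abs_sum_le_sum_abs _ _
    _ ≤ ∑ a, (π.prob s a * B + M.α) := by
        refine Finset.sum_le_sum fun a _ => ?_
        rw [abs_mul, abs_of_nonneg (π.prob_nonneg s a)]
        have h1 := mul_abs_log_le (π.prob_nonneg s a) (π.prob_le_one s a)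
        have hα := M.α_pos
        have h2 : |q (s, a) - M.α * π.logProb (s, a)| ≤
            |q (s, a)| + M.α * |Real.log (π.prob s a)| := by
          refine (abs_sub _ _).trans_eq ?_
          rw [abs_mul, abs_of_pos hα]
          rfl
        have h3 : π.prob s a * |q (s, a)| ≤ π.prob s a * B := by
          rcases (π.prob_nonneg s a).eq_or_lt with h0 | h0
          · simp [← h0]
          · exact mul_le_mul_of_nonneg_left (h a h0) h0.le
        calc π.prob s a * |q (s, a) - M.α * π.logProb (s, a)|
            ≤ π.prob s a * (|q (s, a)| + M.α * |Real.log (π.prob s a)|) :=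
              mul_le_mul_of_nonneg_left h2 (π.prob_nonneg s a)
          _ = π.prob s a * |q (s, a)| + M.α * (π.prob s a * |Real.log (π.prob s a)|) := by ring
          _ ≤ π.prob s a * B + M.α * 1 := by gcongr
          _ = _ := by ring
    _ = B + M.α * Fintype.card A := by
        rw [Finset.sum_add_distrib, ← Finset.sum_mul, π.sum_prob, one_mul]
        simp [mul_comm]

theorem measurable_polValue [MeasurableSingletonClass A] (π : Policy S A) {q : S × A → ℝ}
    (hq : Measurable q) : Measurable (M.polValue π q) :=
  Finset.measurable_sum _ fun a _ => (π.measurable_prob_left a).mul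
    ((hq.comp measurable_prodMk_right).sub
      ((π.measurable_logProb.comp measurable_prodMk_right).const_mul _))

theorem bddMeas_polValue [MeasurableSingletonClass A] (π : Policy S A) {q : S × A → ℝ}
    (hq : BddMeas q) : BddMeas (M.polValue π q) :=
  ⟨M.measurable_polValue π hq.measurable, hq.bounded.imp' (fun B => B + M.α * Fintype.card A)
    fun _ hB _ => M.abs_polValue_le π fun _ _ => hB _⟩

/-- The right side is α times the divergence of π from the softmax weights. In terms of `klFun`, t
log t + 1 - t, every summand is nonnegative and vanishes only at ratio 1, so both the inequality and
its equality case can be read off; the extra linear terms cancel because both weights sum to 1. -/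
theorem softValue_sub_polValue [MeasurableSingletonClass A] [Nonempty A] (π : Policy S A)
    (q : S × A → ℝ) (s : S) :
    softValue M.α q s - M.polValue π q s = M.α * ∑ a, softProb M.α q s a *
      InformationTheory.klFun (π.prob s a / softProb M.α q s a) := by
  have hα := M.α_pos.ne'
  have h : ∀ a, softProb M.α q s a * InformationTheory.klFun (π.prob s a / softProb M.α q s a) =
      π.prob s a * Real.log (π.prob s a) - π.prob s a * (q (s, a) / M.α)
        + π.prob s a * Real.log (∑ b, Real.exp (q (s, b) / M.α))
        + softProb M.α q s a - π.prob s a := by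
    intro a
    have hσ := (softProb_pos M.α q s a).ne'
    rw [InformationTheory.klFun]
    rcases eq_or_ne (π.prob s a) 0 with h0 | h0
    · simp [h0]
    · rw [Real.log_div h0 hσ, log_softProb]
      field_simp
      ring
  simp_rw [h]
  rw [Finset.sum_sub_distrib, Finset.sum_add_distrib, Finset.sum_add_distrib,
    Finset.sum_sub_distrib, π.sum_prob, sum_softProb, ← Finset.sum_mul, π.sum_prob]
  rw [softValue, polValue]
  have h1 : ∑ a, π.prob s a * (q (s, a) - M.α * π.logProb (s, a)) =
      M.α * ∑ a, π.prob s a * (q (s, a) / M.α)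
        - M.α * ∑ a, π.prob s a * Real.log (π.prob s a) := by
    rw [Finset.mul_sum, Finset.mul_sum, ← Finset.sum_sub_distrib]
    refine Finset.sum_congr rfl fun a _ => ?_
    rw [Policy.logProb]
    field_simp
  rw [h1]
  ring

/-- Gibbs' variational principle. -/
theorem polValue_le_softValue [MeasurableSingletonClass A] [Nonempty A] (π : Policy S A)
    (q : S × A → ℝ) (s : S) : M.polValue π q s ≤ softValue M.α q s := by
  rw [← sub_nonneg, softValue_sub_polValue]
  refine mul_nonneg M.α_pos.le (Finset.sum_nonneg fun a _ =>
    mul_nonneg (softProb_pos _ _ _ _).le (InformationTheory.klFun_nonneg ?_))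
  exact div_nonneg (π.prob_nonneg s a) (softProb_pos _ _ _ _).le

theorem polValue_eq_softValue_iff [MeasurableSingletonClass A] [Nonempty A] (π : Policy S A)
    (q : S × A → ℝ) (s : S) :
    M.polValue π q s = softValue M.α q s ↔ ∀ a, π.prob s a = softProb M.α q s a := by
  have hd : ∀ a, 0 ≤ π.prob s a / softProb M.α q s a := fun a =>
    div_nonneg (π.prob_nonneg s a) (softProb_pos _ _ _ _).le
  rw [eq_comm, ← sub_eq_zero, softValue_sub_polValue, mul_eq_zero, or_iff_right M.α_pos.ne',
    Finset.sum_eq_zero_iff_of_nonneg fun a _ => mul_nonneg (softProb_pos _ _ _ _).le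
      (InformationTheory.klFun_nonneg (hd a))]
  refine ⟨fun h a => ?_, fun h a _ => ?_⟩
  · have := h a (Finset.mem_univ a)
    rw [mul_eq_zero, or_iff_right (softProb_pos _ _ _ _).ne',
      InformationTheory.klFun_eq_zero_iff (hd a), div_eq_one_iff_eq (softProb_pos _ _ _ _).ne'] at this
    exact this
  · rw [h a, div_self (softProb_pos _ _ _ _).ne', InformationTheory.klFun_one, mul_zero]

/-! ## Soft policy iteration -/

variable {M} {R : ℝ} (hR : ∀ s a s', |M.reward s a s'| ≤ R)

include hR

omit [Fintype A] in
theorem integrable_backup {v : S → ℝ} (hv : BddMeas v) (x : S × A) :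
    Integrable (fun s => M.reward x.1 x.2 s + M.γ * v s) (M.transition.1 x) := by
  have hr : Measurable fun s => M.reward x.1 x.2 s :=
    M.measurable_reward.comp (f := fun s => (x.1, x.2, s)) (by fun_prop)
  exact (Integrable.of_bound hr.aestronglyMeasurable R (.of_forall fun s => hR _ _ _)).add
    ((hv.integrable _).const_mul _)

omit [Fintype A] in
-- Monotonicity and γ-contraction in one inequality. An almost-everywhere hypothesis suffices, which
-- matters because improved policies are known only up to null sets.
theorem backup_le_add {v v' : S → ℝ} (hv : BddMeas v) (hv' : BddMeas v') {x : S × A} {c : ℝ}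
    (h : ∀ᵐ s ∂(M.transition.1 x), v s ≤ v' s + c) :
    M.backup v x ≤ M.backup v' x + M.γ * c := by
  have hi := integrable_backup hR hv' x
  calc M.backup v x ≤ ∫ s, ((M.reward x.1 x.2 s + M.γ * v' s) + M.γ * c) ∂(M.transition.1 x) := by
        refine integral_mono_ae (integrable_backup hR hv x) (hi.add (integrable_const _)) ?_
        filter_upwards [h] with s hs
        have := mul_le_mul_of_nonneg_left hs M.γ_pos.le
        linarith
    _ = _ := by
        rw [integral_add hi (integrable_const _), backup]
        simp

omit [Fintype A] in
theorem bddMeas_backup {v : S → ℝ} (hv : BddMeas v) : BddMeas (M.backup v) := by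
  refine ⟨?_, ?_⟩
  · have : Measurable fun w : (S × A) × S => M.reward w.1.1 w.1.2 w.2 + M.γ * v w.2 :=
      (M.measurable_reward.comp (f := fun w : (S × A) × S => (w.1.1, w.1.2, w.2)) (by fun_prop)).add
        ((hv.measurable.comp measurable_snd).const_mul _)
    exact (this.stronglyMeasurable.integral_kernel_prod_right' (κ := M.transition.1)).measurable
  · obtain ⟨B, hB⟩ := hv.bounded
    refine ⟨R + M.γ * B, fun x => ?_⟩
    have h : ∀ s, ‖M.reward x.1 x.2 s + M.γ * v s‖ ≤ R + M.γ * B := by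
      intro s
      refine (norm_add_le _ _).trans (add_le_add (hR _ _ _) ?_)
      rw [norm_mul, Real.norm_of_nonneg M.γ_pos.le]
      exact mul_le_mul_of_nonneg_left (hB s) M.γ_pos.le
    simpa [DecisionProcess.backup] using
      norm_integral_le_of_norm_le_const (μ := M.transition.1 x) (.of_forall h)

theorem bddMeas_Q [MeasurableSingletonClass A] (π : Policy S A) :
    BddMeas fun x : S × A => M.Q π x.1 x.2 :=
  ⟨measurable_Q π, _, abs_Q_le hR π⟩

omit hR in
-- One-sided contraction: each upper bound c can be replaced by γ c, so f ≤ γ ^ n * B for every n.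
-- It serves to compare action values in the Bellman inequalities below.
theorem nonpos_of_forall_le_mul {X : Type*} {γ : ℝ} (h0 : 0 ≤ γ) (h1 : γ < 1) {f : X → ℝ} {B : ℝ}
    (hB : ∀ x, f x ≤ B) (h : ∀ c, (∀ x, f x ≤ c) → ∀ x, f x ≤ γ * c) (x : X) : f x ≤ 0 := by
  have hn : ∀ n : ℕ, ∀ x, f x ≤ γ ^ n * B := by
    intro n
    induction n with
    | zero => simpa using hB
    | succ n ih => intro x; rw [pow_succ', mul_assoc]; exact h _ ih x
  have := (tendsto_pow_atTop_nhds_zero_of_lt_one h0 h1).mul_const B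
  rw [zero_mul] at this
  exact ge_of_tendsto' this fun n => hn n x

/-- The soft Bellman optimality equation has a bounded measurable solution. -/
theorem exists_soft_optimal [Nonempty A] :
    ∃ q : S × A → ℝ, BddMeas q ∧ ∀ x, q x = M.backup (softValue M.α q) x := by
  set T : (S × A → ℝ) → S × A → ℝ := fun q => M.backup (softValue M.α q) with hT
  have hTb : ∀ q, BddMeas q → BddMeas (T q) := fun q hq =>
    bddMeas_backup hR (BddMeas.softValue M.α_pos hq)
  have hle : ∀ q q' : S × A → ℝ, BddMeas q → BddMeas q' → ∀ c, (∀ x, q x ≤ q' x + c) →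
      ∀ x, T q x ≤ T q' x + M.γ * c := fun q q' hq hq' c h x =>
    backup_le_add hR (BddMeas.softValue M.α_pos hq) (BddMeas.softValue M.α_pos hq')
      (.of_forall fun s => softValue_le_add M.α_pos fun a => h (s, a))
  have hdist : ∀ q q' : S × A → ℝ, BddMeas q → BddMeas q' → ∀ c, (∀ x, |q x - q' x| ≤ c) →
      ∀ x, |T q x - T q' x| ≤ M.γ * c := by
    intro q q' hq hq' c h x
    have h1 := hle q q' hq hq' c (fun x => by linarith [(abs_le.1 (h x)).2]) x
    have h2 := hle q' q hq' hq c (fun x => by linarith [(abs_le.1 (h x)).1]) x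
    rw [abs_le]
    constructor <;> linarith
  -- Banach iteration from 0, carried out by hand: successive distances decay geometrically, so the
  -- iterates converge uniformly, and a pointwise limit of measurable functions is measurable.
  set u : ℕ → S × A → ℝ := fun n => T^[n] 0 with hu
  have hus : ∀ n, u (n + 1) = T (u n) := fun n => Function.iterate_succ_apply' T n 0
  have hub : ∀ n, BddMeas (u n) := by
    intro n
    induction n with
    | zero => exact ⟨measurable_const, 0, fun x => by simp [hu]⟩
    | succ n ih => rw [hus]; exact hTb _ ih
  obtain ⟨B, hB⟩ := (hub 1).bounded
  have hstep : ∀ n x, |u n x - u (n + 1) x| ≤ B * M.γ ^ n := by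
    intro n
    induction n with
    | zero => intro x; simpa [hu] using hB x
    | succ n ih =>
      intro x
      rw [hus (n + 1), hus n]
      refine (hdist _ _ (hub n) (hub (n + 1)) _ ih x |>.trans_eq' (by rw [hus n])).trans_eq ?_
      ring
  have hc : ∀ x, ∃ l, Filter.Tendsto (fun n => u n x) Filter.atTop (nhds l) := fun x =>
    cauchySeq_tendsto_of_complete
      (cauchySeq_of_le_geometric M.γ B M.γ_lt_one fun n => hstep n x)
  choose q hq using hc
  have hqd : ∀ n x, |u n x - q x| ≤ B * M.γ ^ n / (1 - M.γ) := fun n x =>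
    dist_le_of_le_geometric_of_tendsto M.γ B M.γ_lt_one (fun n => hstep n x) (hq x) n
  have hqb : BddMeas q := by
    refine ⟨measurable_of_tendsto_metrizable (fun n => (hub n).measurable)
      (tendsto_pi_nhds.2 hq), B * M.γ ^ 0 / (1 - M.γ), fun x => ?_⟩
    have := hqd 0 x
    rwa [show u 0 x = 0 from rfl, zero_sub, abs_neg] at this
  refine ⟨q, hqb, fun x => tendsto_nhds_unique ((Filter.tendsto_add_atTop_iff_nat 1).2 (hq x)) ?_⟩
  rw [tendsto_iff_dist_tendsto_zero]
  refine squeeze_zero (fun _ => dist_nonneg)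
    (g := fun n => M.γ * (B * M.γ ^ n / (1 - M.γ))) (fun n => ?_) ?_
  · rw [hus n]
    exact hdist _ _ (hub n) hqb _ (hqd n) x
  · have := (((tendsto_pow_atTop_nhds_zero_of_lt_one M.γ_pos.le M.γ_lt_one).const_mul
      B).div_const (1 - M.γ)).const_mul M.γ
    simpa using this

variable [MeasurableSingletonClass A] [Nonempty A]

/-- Q^π solves the Bellman equation with the value of π, which Gibbs' principle bounds by the soft
maximum. So an upper bound c for Q^π - q improves to γ c. -/
theorem Q_le_of_soft_optimal {q : S × A → ℝ} (hq : BddMeas q)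
    (hfix : ∀ x, q x = M.backup (softValue M.α q) x) (π : Policy S A) (x : S × A) :
    M.Q π x.1 x.2 ≤ q x := by
  obtain ⟨B, hB⟩ := hq.bounded
  have hQ := bddMeas_Q hR π
  obtain ⟨B', hB'⟩ := hQ.bounded
  rw [← sub_nonpos]
  refine nonpos_of_forall_le_mul M.γ_pos.le M.γ_lt_one
    (f := fun x : S × A => M.Q π x.1 x.2 - q x) (B := B' + B) (fun x => ?_) (fun c hc x => ?_) x
  · have := (abs_le.1 (hB x)).1
    have := (abs_le.1 (hB' x)).2
    linarith
  · have := backup_le_add hR (x := x) (bddMeas_polValue M π hQ) (BddMeas.softValue M.α_pos hq)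
      (c := c) (.of_forall fun s => (M.polValue_le_softValue π _ s).trans
        (softValue_le_add M.α_pos fun a => by linarith [hc (s, a)]))
    rw [← Q_eq_backup hR, ← hfix] at this
    linarith

omit hR in
theorem polValue_softPolicy {q : S × A → ℝ} (hq : Measurable q) (s : S) :
    M.polValue (softPolicy M.α q hq) q s = softValue M.α q s :=
  (M.polValue_eq_softValue_iff _ q s).2 fun a => softPolicy_prob M.α q hq s a

/-- For the softmax policy of `q`, Gibbs' inequality is an equality at `q`; hence the comparison
also runs in the other direction. -/
theorem Q_softPolicy {q : S × A → ℝ} (hq : BddMeas q)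
    (hfix : ∀ x, q x = M.backup (softValue M.α q) x) (x : S × A) :
    M.Q (softPolicy M.α q hq.measurable) x.1 x.2 = q x := by
  set π := softPolicy M.α q hq.measurable
  refine le_antisymm (Q_le_of_soft_optimal hR hq hfix π x) ?_
  obtain ⟨B, hB⟩ := hq.bounded
  have hQ := bddMeas_Q hR π
  obtain ⟨B', hB'⟩ := hQ.bounded
  rw [← sub_nonpos]
  refine nonpos_of_forall_le_mul M.γ_pos.le M.γ_lt_one
    (f := fun x : S × A => q x - M.Q π x.1 x.2) (B := B + B') (fun x => ?_) (fun c hc x => ?_) x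
  · have := (abs_le.1 (hB x)).2
    have := (abs_le.1 (hB' x)).1
    linarith
  · have := backup_le_add hR (x := x) (BddMeas.softValue M.α_pos hq) (bddMeas_polValue M π hQ)
      (c := c) (.of_forall fun s => by
        rw [← polValue_softPolicy hq.measurable s]
        exact M.polValue_le_add π fun a => by linarith [hc (s, a)])
    rw [← Q_eq_backup hR, ← hfix] at this
    linarith

/-- Soft policy improvement. -/
theorem backup_softValue_Q_le {π π' : Policy S A}
    (h : ∀ x, ∀ᵐ s ∂(M.transition.1 x), ∀ a,
      π'.prob s a = softProb M.α (fun y => M.Q π y.1 y.2) s a) (x : S × A) :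
    M.backup (softValue M.α fun y => M.Q π y.1 y.2) x ≤ M.Q π' x.1 x.2 := by
  have hQ := bddMeas_Q hR π
  have hQ' := bddMeas_Q hR π'
  obtain ⟨B, hB⟩ := hQ.bounded
  obtain ⟨B', hB'⟩ := hQ'.bounded
  -- Used twice: with general c it shows that the improved policy is no worse, and then with c = 0
  -- it gives the claim.
  have key : ∀ c, (∀ x : S × A, M.Q π x.1 x.2 - M.Q π' x.1 x.2 ≤ c) → ∀ x,
      M.backup (softValue M.α fun y => M.Q π y.1 y.2) x ≤ M.Q π' x.1 x.2 + M.γ * c := by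
    intro c hc x
    rw [Q_eq_backup hR π' x]
    refine backup_le_add hR (BddMeas.softValue M.α_pos hQ) (bddMeas_polValue M π' hQ') ?_
    filter_upwards [h x] with s hs
    rw [← (M.polValue_eq_softValue_iff π' _ s).2 hs]
    exact M.polValue_le_add π' fun a => by linarith [hc (s, a)]
  have hmono : ∀ x : S × A, M.Q π x.1 x.2 - M.Q π' x.1 x.2 ≤ 0 := by
    refine nonpos_of_forall_le_mul M.γ_pos.le M.γ_lt_one
      (f := fun x : S × A => M.Q π x.1 x.2 - M.Q π' x.1 x.2) (B := B + B') (fun x => ?_)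
      (fun c hc x => ?_)
    · have := (abs_le.1 (hB x)).2
      have := (abs_le.1 (hB' x)).1
      linarith
    · have h1 := backup_le_add hR (x := x) (c := 0) (bddMeas_polValue M π hQ)
        (BddMeas.softValue M.α_pos hQ)
        (.of_forall fun s => by simpa using M.polValue_le_softValue π _ s)
      rw [← Q_eq_backup hR] at h1
      linarith [key c hc x]
  simpa using key 0 hmono x

/-- Soft policy iteration converges geometrically. -/
theorem tendsto_Q_of_improve {q : S × A → ℝ} (hq : BddMeas q)
    (hfix : ∀ x, q x = M.backup (softValue M.α q) x) {π : ℕ → Policy S A}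
    (h : ∀ k x, ∀ᵐ s ∂(M.transition.1 x), ∀ a,
      (π (k + 1)).prob s a = softProb M.α (fun y => M.Q (π k) y.1 y.2) s a) (x : S × A) :
    Filter.Tendsto (fun k => M.Q (π k) x.1 x.2) Filter.atTop (nhds (q x)) := by
  obtain ⟨B, hB⟩ := hq.bounded
  obtain ⟨B', hB'⟩ := (bddMeas_Q hR (π 0)).bounded
  -- One round of improvement dominates one application of the optimality operator, so the gap to
  -- its fixed point shrinks by γ.
  have hk : ∀ k, ∀ x : S × A, q x ≤ M.Q (π k) x.1 x.2 + M.γ ^ k * (B + B') := by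
    intro k
    induction k with
    | zero =>
      intro x
      have := (abs_le.1 (hB x)).2
      have := (abs_le.1 (hB' x)).1
      simp only [pow_zero, one_mul] at *
      linarith
    | succ k ih =>
      intro x
      have h1 := backup_softValue_Q_le hR (h k) x
      have h2 := backup_le_add hR (x := x) (BddMeas.softValue M.α_pos hq)
        (BddMeas.softValue M.α_pos (bddMeas_Q hR (π k)))
        (.of_forall fun s => softValue_le_add M.α_pos fun a => ih (s, a))
      rw [← hfix] at h2
      rw [pow_succ', mul_assoc]
      linarith
  have h0 := (tendsto_pow_atTop_nhds_zero_of_lt_one M.γ_pos.le M.γ_lt_one).mul_const (B + B')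
  refine tendsto_of_tendsto_of_tendsto_of_le_of_le (g := fun k => q x - M.γ ^ k * (B + B'))
    (h := fun _ => q x) (by simpa using tendsto_const_nhds.sub h0) tendsto_const_nhds
    (fun k => ?_) (fun k => Q_le_of_soft_optimal hR hq hfix (π k) x)
  linarith [hk k x]

end DecisionProcess

/-! ## Occupancy measures -/

theorem lintegral_chain_eval_succ_eq {X : Type*} [MeasurableSpace X] (κ : Kernel X X)
    [IsMarkovKernel κ] (n : ℕ) {f : X → ℝ≥0∞} (hf : Measurable f) (x : X) :
    ∫⁻ τ, f (τ (n + 1)) ∂(chain κ x) = ∫⁻ τ, ∫⁻ y, f y ∂(κ (τ n)) ∂(chain κ x) := by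
  have hg : Measurable fun z => ∫⁻ y, f y ∂(κ z) := hf.lintegral_kernel
  induction n generalizing x with
  | zero =>
    rw [lintegral_chain_eval_succ κ x 0 hf, lintegral_chain_eval_zero κ x hg]
    simp_rw [fun y => lintegral_chain_eval_zero κ y hf]
  | succ n ih =>
    rw [lintegral_chain_eval_succ κ x (n + 1) hf, lintegral_chain_eval_succ κ x n hg]
    simp_rw [ih]

namespace DecisionProcess

variable {S A : Type*} [MeasurableSpace S] [MeasurableSpace A] (M : DecisionProcess S A)

/-- The law of the observation at time `t` when the initial law is `μ`. -/
noncomputable def stateLaw (π : Policy S A) (μ : ProbabilityMeasure S) : ℕ → Measure S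
  | 0 => μ
  | t + 1 => ((stateLaw π μ t).compProd π.1).bind M.transition.1

instance (π : Policy S A) (μ : ProbabilityMeasure S) (t : ℕ) :
    IsProbabilityMeasure (M.stateLaw π μ t) := by
  induction t with
  | zero => unfold stateLaw; infer_instance
  | succ t ih => unfold stateLaw; infer_instance

/-- At every time the action is drawn from π given the state. In this factored form null sets of
states and of actions can be handled separately. -/
theorem map_eval_trajectory_eq (π : Policy S A) (μ : ProbabilityMeasure S) (t : ℕ) :
    (((μ : Measure S).compProd π.1).bind (M.trajectory π)).map (fun τ => τ t) =
      (M.stateLaw π μ t).compProd π.1 := by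
  have hl : ∀ (t : ℕ) (f : S × A → ℝ≥0∞), Measurable f →
      ∫⁻ y, f y ∂((((μ : Measure S).compProd π.1).bind (M.trajectory π)).map fun τ => τ t) =
        ∫⁻ x, ∫⁻ τ, f (τ t) ∂(M.trajectory π x) ∂((μ : Measure S).compProd π.1) := by
    intro t f hf
    rw [lintegral_map hf (measurable_pi_apply t), Measure.lintegral_bind (Kernel.aemeasurable _)]
    exact (hf.comp (measurable_pi_apply t)).aemeasurable
  induction t with
  | zero =>
    refine Measure.ext_of_lintegral _ fun f hf => ?_
    rw [hl 0 f hf]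
    exact lintegral_congr fun x => lintegral_chain_eval_zero (M.step π) x hf
  | succ t ih =>
    refine Measure.ext_of_lintegral _ fun f hf => ?_
    have hg : Measurable fun z => ∫⁻ y, f y ∂(M.step π z) := hf.lintegral_kernel
    have h1 : ∫⁻ x, ∫⁻ τ, f (τ (t + 1)) ∂(M.trajectory π x) ∂((μ : Measure S).compProd π.1) =
        ∫⁻ x, ∫⁻ τ, ∫⁻ y, f y ∂(M.step π (τ t)) ∂(M.trajectory π x)
          ∂((μ : Measure S).compProd π.1) :=
      lintegral_congr fun x => lintegral_chain_eval_succ_eq (M.step π) t hf x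
    have hfa : Measurable fun s => ∫⁻ a, f (s, a) ∂(π.1 s) := hf.lintegral_kernel_prod_right'
    rw [hl _ f hf, h1, ← hl t _ hg, ih, stateLaw, Measure.lintegral_compProd hf,
      Measure.lintegral_bind (Kernel.aemeasurable _) hfa.aemeasurable]
    exact lintegral_congr fun x => M.lintegral_step π x hf

theorem occupancy_eq (π : Policy S A) (μ : ProbabilityMeasure S) :
    M.occupancy π μ = Measure.sum fun t : ℕ =>
      ENNReal.ofReal ((1 - M.γ) * M.γ ^ t) • (M.stateLaw π μ t).compProd π.1 := by
  simp_rw [occupancy, map_eval_trajectory_eq]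

instance (π : Policy S A) (μ : ProbabilityMeasure S) : IsFiniteMeasure (M.occupancy π μ) := by
  refine ⟨?_⟩
  rw [occupancy_eq, Measure.sum_apply _ MeasurableSet.univ]
  simp only [Measure.smul_apply, measure_univ, smul_eq_mul, mul_one]
  exact (((summable_geometric_of_lt_one M.γ_pos.le M.γ_lt_one).mul_left
    (1 - M.γ)).tsum_ofReal_ne_top).lt_top

/-- All the discount weights are positive, so none of the time marginals is lost. -/
theorem ae_occupancy_iff {π : Policy S A} {μ : ProbabilityMeasure S} {p : S × A → Prop} :
    (∀ᵐ x ∂(M.occupancy π μ), p x) ↔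
      ∀ t, ∀ᵐ x ∂((M.stateLaw π μ t).compProd π.1), p x := by
  rw [occupancy_eq, Measure.ae_sum_iff]
  refine forall_congr' fun t => ?_
  refine Measure.ae_ennreal_smul_measure_iff ?_
  have : 0 < (1 - M.γ) * M.γ ^ t :=
    mul_pos (sub_pos.2 M.γ_lt_one) (pow_pos M.γ_pos t)
  simpa using this

theorem stateLaw_succ_compProd (π : Policy S A) (μ : ProbabilityMeasure S) (t : ℕ) :
    (M.stateLaw π μ (t + 1)).compProd π.1 =
      ((M.stateLaw π μ t).compProd π.1).bind (M.step π) := by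
  refine Measure.ext_of_lintegral _ fun f hf => ?_
  have hfa : Measurable fun s => ∫⁻ a, f (s, a) ∂(π.1 s) := hf.lintegral_kernel_prod_right'
  rw [stateLaw, Measure.lintegral_compProd hf,
      Measure.lintegral_bind (Kernel.aemeasurable _) hfa.aemeasurable,
      Measure.lintegral_bind (Kernel.aemeasurable _) hf.aemeasurable]
  exact lintegral_congr fun x => (M.lintegral_step π x hf).symm

/-- The law at time t pushed through one step is the law at time t + 1, which the occupancy measure
already charges. -/
theorem ae_step_of_ae_occupancy {π : Policy S A} {μ : ProbabilityMeasure S} {p : S × A → Prop}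
    (h : ∀ᵐ x ∂(M.occupancy π μ), p x) :
    ∀ᵐ x ∂(M.occupancy π μ), ∀ᵐ y ∂(M.step π x), p y := by
  rw [ae_occupancy_iff] at h ⊢
  intro t
  have := h (t + 1)
  rw [stateLaw_succ_compProd] at this
  exact Measure.ae_ae_of_ae_comp this

/-- Domination of the policies is needed only where π goes. It propagates through the state laws by
induction on time. -/
theorem occupancy_absolutelyContinuous {π π' : Policy S A} {μ : ProbabilityMeasure S}
    (h : ∀ᵐ x ∂(M.occupancy π μ), π.1 x.1 ≪ π'.1 x.1) :
    M.occupancy π μ ≪ M.occupancy π' μ := by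
  have hs : ∀ t, ∀ᵐ s ∂(M.stateLaw π μ t), π.1 s ≪ π'.1 s := by
    intro t
    filter_upwards [Measure.ae_ae_of_ae_compProd ((ae_occupancy_iff M).1 h t)] with s hs
    exact Filter.eventually_const.1 hs
  have hν : ∀ t, M.stateLaw π μ t ≪ M.stateLaw π' μ t := by
    intro t
    induction t with
    | zero => exact Measure.AbsolutelyContinuous.rfl
    | succ t ih =>
      exact ((Measure.AbsolutelyContinuous.compProd ih (hs t))).comp_right M.transition.1
  refine Measure.AbsolutelyContinuous.mk fun E _ hE => ?_
  have hE' := (ae_occupancy_iff M (π := π') (p := fun x => x ∉ E)).1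
    (measure_eq_zero_iff_ae_notMem.1 hE)
  exact measure_eq_zero_iff_ae_notMem.2 ((ae_occupancy_iff M).2 fun t =>
    (Measure.AbsolutelyContinuous.compProd (hν t) (hs t)).ae_le (hE' t))

variable [Fintype A]

/-- A policy that gives every action positive mass has no nonempty null set of actions, so one good
action can be upgraded to all of them. -/
theorem ae_forall_action {π : Policy S A} (hπ : ∀ s a, 0 < π.prob s a)
    {μ : ProbabilityMeasure S} {p : S × A → Prop} (h : ∀ᵐ x ∂(M.occupancy π μ), p x) :
    ∀ᵐ x ∂(M.occupancy π μ), ∀ a, p (x.1, a) := by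
  rw [ae_occupancy_iff] at h ⊢
  intro t
  have h1 : ∀ᵐ s ∂(M.stateLaw π μ t), ∀ a, p (s, a) := by
    filter_upwards [Measure.ae_ae_of_ae_compProd (h t)] with s hs a
    exact (π.ae_iff s _).1 hs a (hπ s a)
  rw [← Measure.fst_compProd (M.stateLaw π μ t) π.1, Measure.fst] at h1
  exact ae_of_ae_map measurable_fst.aemeasurable h1

theorem absolutelyContinuous_of_pos {π π' : Policy S A} {s : S} (h : ∀ a, 0 < π'.prob s a) :
    π.1 s ≪ π'.1 s := by
  refine Measure.AbsolutelyContinuous.mk fun E _ hE => ?_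
  have : E = ∅ := by
    refine Set.eq_empty_of_forall_notMem fun a ha => ?_
    exact (π'.ae_iff s _).1 (measure_eq_zero_iff_ae_notMem.1 hE) a (h a) ha
  simp [this]

omit [Fintype A] in
theorem ae_transition_of_explores {π : Policy S A} {I : Set (ProbabilityMeasure S)}
    (hI : M.Explores π I) {p : S → Prop} (hp : MeasurableSet {s | p s})
    (h : ∀ μ ∈ I, ∀ᵐ x ∂(M.occupancy π μ), p x.1) (x : S × A) :
    ∀ᵐ s ∂(M.transition.1 x), p s := by
  refine hI {s | p s}ᶜ hp.compl (fun μ hμ => ?_) x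
  rw [measure_eq_zero_iff_ae_notMem]
  filter_upwards [h μ hμ] with y hy
  simpa using hy

end DecisionProcess

/-! ## The evaluation objective -/

/-- A jointly measurable version of the density comes from the Radon–Nikodym theorem for kernels.
Measurability lets a zero integral of divergences force almost every divergence to vanish. -/
theorem measurable_klDiv {X : Type*} [MeasurableSpace X] (κ η : Kernel X ℝ) [IsFiniteKernel κ]
    [IsFiniteKernel η] : Measurable fun x => InformationTheory.klDiv (κ x) (η x) := by
  classical
  have h : ∀ x, InformationTheory.klDiv (κ x) (η x) = if κ x ≪ η x then
      ∫⁻ z, ENNReal.ofReal (InformationTheory.klFun (Kernel.rnDeriv κ η x z).toReal) ∂(η x)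
      else ∞ := by
    intro x
    rw [InformationTheory.klDiv_eq_lintegral_klFun]
    congr 1
    refine lintegral_congr_ae ?_
    filter_upwards [Kernel.rnDeriv_eq_rnDeriv_measure (κ := κ) (η := η) (a := x)] with z hz
    rw [hz]
  simp_rw [h]
  refine Measurable.ite (Kernel.measurableSet_absolutelyContinuous κ η) ?_ measurable_const
  have hm : Measurable fun w : X × ℝ =>
      ENNReal.ofReal (InformationTheory.klFun (Kernel.rnDeriv κ η w.1 w.2).toReal) :=
    (InformationTheory.measurable_klFun.comp
      (Kernel.measurable_rnDeriv κ η).ennreal_toReal).ennreal_ofReal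
  exact hm.lintegral_kernel_prod_right'

namespace DecisionProcess

variable {S A : Type*} [MeasurableSpace S] [MeasurableSpace A] {M : DecisionProcess S A}
  [Fintype A] [MeasurableSingletonClass A]

theorem evalObjective_bellmanKernel (π : Policy S A) (μ : ProbabilityMeasure S)
    (Z : ReturnDist S A) : M.evalObjective π μ Z (M.bellmanKernel π Z) = 0 := by
  simp [evalObjective, bellmanKernel_apply]

theorem ae_eq_of_evalObjective_eq_zero {π : Policy S A} {μ : ProbabilityMeasure S}
    {Z Z' : ReturnDist S A} (h : M.evalObjective π μ Z Z' = 0) :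
    ∀ᵐ x ∂(M.occupancy π μ), Z'.1 x = M.bellman π Z x := by
  simp_rw [evalObjective, ← bellmanKernel_apply] at h
  rw [lintegral_eq_zero_iff (measurable_klDiv _ _)] at h
  filter_upwards [h] with x hx
  rw [← bellmanKernel_apply]
  exact (InformationTheory.klDiv_eq_zero_iff.1 hx).symm

omit [Fintype A] [MeasurableSingletonClass A] in
theorem ae_bellman_congr {π : Policy S A} {μ : ProbabilityMeasure S} {Z Z' : ReturnDist S A}
    (h : ∀ᵐ x ∂(M.occupancy π μ), Z.1 x = Z'.1 x) :
    ∀ᵐ x ∂(M.occupancy π μ), M.bellman π Z x = M.bellman π Z' x := by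
  filter_upwards [M.ae_step_of_ae_occupancy h] with x hx
  rw [bellman, bellman, Measure.compProd_congr hx]

/-! ## The improvement objective -/

theorem improveObjective_eq (πold : Policy S A) (μ : ProbabilityMeasure S) (Z : ReturnDist S A)
    (π : Policy S A) : M.improveObjective πold μ Z π =
      ∫ x, M.polValue π (fun y => ∫ z, z ∂(Z.1 y)) x.1 ∂(M.occupancy πold μ) := by
  simp_rw [improveObjective, Policy.integral_eq]
  rfl

variable {πold : Policy S A} {μ : ProbabilityMeasure S} {q : S × A → ℝ}

theorem integrable_polValue (hq : Measurable q) {B : ℝ}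
    (hB : ∀ᵐ x ∂(M.occupancy πold μ), ∀ a, |q (x.1, a)| ≤ B) (π : Policy S A) :
    Integrable (fun x : S × A => M.polValue π q x.1) (M.occupancy πold μ) := by
  refine .of_bound ((M.measurable_polValue π hq).comp measurable_fst).aestronglyMeasurable
    (B + M.α * Fintype.card A) ?_
  filter_upwards [hB] with x hx
  exact M.abs_polValue_le π fun a _ => hx a

variable [Nonempty A]

theorem improveObjective_le_softPolicy {Z : ReturnDist S A} {B : ℝ}
    (hB : ∀ᵐ x ∂(M.occupancy πold μ), ∀ a, |∫ z, z ∂(Z.1 (x.1, a))| ≤ B) (π : Policy S A) :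
    M.improveObjective πold μ Z π ≤ M.improveObjective πold μ Z
      (softPolicy M.α (fun y => ∫ z, z ∂(Z.1 y)) (measurable_integral_returnDist Z)) := by
  have hm := measurable_integral_returnDist Z
  rw [improveObjective_eq, improveObjective_eq]
  refine integral_mono (integrable_polValue hm hB _) (integrable_polValue hm hB _) fun x => ?_
  rw [polValue_softPolicy]
  exact M.polValue_le_softValue _ _ _

/-- Pointwise the softmax policy is the unique maximiser, so equal integrals force equality almost
everywhere. The bound on the means provides the integrability without which the Bochner integrals
would carry no information. -/
theorem ae_eq_softProb_of_improveObjective_ge {Z : ReturnDist S A} {B : ℝ}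
    (hB : ∀ᵐ x ∂(M.occupancy πold μ), ∀ a, |∫ z, z ∂(Z.1 (x.1, a))| ≤ B) {π : Policy S A}
    (h : M.improveObjective πold μ Z
      (softPolicy M.α (fun y => ∫ z, z ∂(Z.1 y)) (measurable_integral_returnDist Z)) ≤
        M.improveObjective πold μ Z π) :
    ∀ᵐ x ∂(M.occupancy πold μ), ∀ a,
      π.prob x.1 a = softProb M.α (fun y => ∫ z, z ∂(Z.1 y)) x.1 a := by
  have hm := measurable_integral_returnDist Z
  rw [improveObjective_eq, improveObjective_eq] at h
  have hle : ∀ x : S × A, M.polValue π (fun y => ∫ z, z ∂(Z.1 y)) x.1 ≤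
      M.polValue (softPolicy M.α (fun y => ∫ z, z ∂(Z.1 y)) hm) (fun y => ∫ z, z ∂(Z.1 y)) x.1 := by
    intro x
    rw [polValue_softPolicy]
    exact M.polValue_le_softValue _ _ _
  have hi := integrable_polValue hm hB π
  have hi' := integrable_polValue hm hB (softPolicy M.α (fun y => ∫ z, z ∂(Z.1 y)) hm)
  have heq := (integral_eq_iff_of_ae_le hi hi' (.of_forall hle)).1
    (le_antisymm (integral_mono hi hi' hle) h)
  filter_upwards [heq] with x hx
  rw [← M.polValue_eq_softValue_iff]
  exact hx.trans (polValue_softPolicy hm _)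

end DecisionProcess

/-! ## Distributional soft policy iteration -/

namespace DecisionProcess

variable {S A : Type*} [MeasurableSpace S] [MeasurableSpace A]

/-- The properties of a run of policy iteration used in the convergence proof, in terms of the
policies and return distributions on observations only. -/
structure IsPolicyIteration (M : DecisionProcess S A) [Fintype A] [Nonempty A]
    (I : Set (ProbabilityMeasure S)) (pol : ℕ → Policy S A) (val : ℕ → ℕ → ReturnDist S A) :
    Prop where
  eval_step : ∀ k i, ∀ μ ∈ I, ∀ᵐ x ∂(M.occupancy (pol k) μ),
    (val k (i + 1)).1 x = M.bellman (pol k) (val k i) x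
  eval_limit : ∀ k, ∀ Z : ReturnDist S A,
    (∀ μ ∈ I, ∀ᵐ x ∂(M.occupancy (pol k) μ), WeaklyConverges (fun i => (val k i).1 x) (Z.1 x)) →
    ∀ μ ∈ I, ∀ᵐ x ∂(M.occupancy (pol k) μ), (val (k + 1) 0).1 x = Z.1 x
  improve : ∀ k, ∀ μ ∈ I,
    M.improveObjective (pol k) μ (val (k + 1) 0)
      (softPolicy M.α (fun y => ∫ z, z ∂((val (k + 1) 0).1 y)) (measurable_integral_returnDist _)) ≤
    M.improveObjective (pol k) μ (val (k + 1) 0) (pol (k + 1))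

variable {M : DecisionProcess S A} [Fintype A] [MeasurableSingletonClass A]

/-- `W` stands in for `V 0`, which may have uncontrolled moments on a null set. -/
theorem ae_eq_iterate_bellmanKernel {π : Policy S A} {μ : ProbabilityMeasure S}
    {V : ℕ → ReturnDist S A} {W : ReturnDist S A}
    (h : ∀ i, ∀ᵐ x ∂(M.occupancy π μ), (V (i + 1)).1 x = M.bellman π (V i) x)
    (h0 : ∀ᵐ x ∂(M.occupancy π μ), (V 0).1 x = W.1 x) (i : ℕ) :
    ∀ᵐ x ∂(M.occupancy π μ), (V i).1 x = ((M.bellmanKernel π)^[i] W).1 x := by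
  induction i with
  | zero => exact h0
  | succ i ih =>
    filter_upwards [h i, ae_bellman_congr ih] with x h1 h2
    rw [h1, h2, Function.iterate_succ_apply', bellmanKernel_apply]

theorem ae_weaklyConverges {R : ℝ} (hR : ∀ s a s', |M.reward s a s'| ≤ R) {π : Policy S A}
    {μ : ProbabilityMeasure S} {V : ℕ → ReturnDist S A} {W : ReturnDist S A} {C : ℝ≥0}
    (hW : ∀ x, ∫⁻ z, ‖z‖ₑ ∂(W.1 x) ≤ C)
    (h : ∀ i, ∀ᵐ x ∂(M.occupancy π μ), (V (i + 1)).1 x = M.bellman π (V i) x)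
    (h0 : ∀ᵐ x ∂(M.occupancy π μ), (V 0).1 x = W.1 x) :
    ∀ᵐ x ∂(M.occupancy π μ), WeaklyConverges (fun i => (V i).1 x) (M.returnLaw π x.1 x.2) := by
  filter_upwards [ae_all_iff.2 fun i => ae_eq_iterate_bellmanKernel h h0 i] with x hx
  simp_rw [hx]
  exact weaklyConverges_iterate hR π hW x

theorem exists_moment_bound {R : ℝ} (hR : ∀ s a s', |M.reward s a s'| ≤ R) :
    ∃ C : ℝ≥0, ∀ (π : Policy S A) x, ∫⁻ z, ‖z‖ₑ ∂((M.returnKernel π).1 x) ≤ C := by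
  refine ⟨(ENNReal.ofReal R + M.tailBound R).toNNReal, fun π x => ?_⟩
  rw [ENNReal.coe_toNNReal (by have := tailBound_ne_top M R; finiteness)]
  exact lintegral_returnKernel_le hR π x

variable [Nonempty A]

namespace IsPolicyIteration

variable {R : ℝ} (hR : ∀ s a s', |M.reward s a s'| ≤ R) {I : Set (ProbabilityMeasure S)}
  {pol : ℕ → Policy S A} {val : ℕ → ℕ → ReturnDist S A} (h : M.IsPolicyIteration I pol val)

include hR h

theorem evaluation {k : ℕ} {W : ReturnDist S A} {C : ℝ≥0}
    (hW : ∀ x, ∫⁻ z, ‖z‖ₑ ∂(W.1 x) ≤ C)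
    (h0 : ∀ μ ∈ I, ∀ᵐ x ∂(M.occupancy (pol k) μ), (val k 0).1 x = W.1 x) :
    ∀ μ ∈ I, ∀ᵐ x ∂(M.occupancy (pol k) μ),
      WeaklyConverges (fun i => (val k i).1 x) (M.returnLaw (pol k) x.1 x.2) ∧
      (val (k + 1) 0).1 x = M.returnLaw (pol k) x.1 x.2 := by
  have hc : ∀ μ ∈ I, ∀ᵐ x ∂(M.occupancy (pol k) μ),
      WeaklyConverges (fun i => (val k i).1 x) (M.returnLaw (pol k) x.1 x.2) := fun μ hμ =>
    ae_weaklyConverges hR hW (fun i => h.eval_step k i μ hμ) (h0 μ hμ)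
  intro μ hμ
  filter_upwards [hc μ hμ, h.eval_limit k (M.returnKernel (pol k))
    (by simpa only [returnKernel_apply] using hc) μ hμ] with x h1 h2
  exact ⟨h1, by rw [h2, returnKernel_apply]⟩

/-- The softmax at a state involves all actions there, while evaluation is known only for almost
every pair. Passing to the occupancy of the fully supported initial policy bridges the gap. -/
theorem improvement (hpos : ∀ s a, 0 < (pol 0).prob s a) {k : ℕ} {μ : ProbabilityMeasure S}
    (hμ : μ ∈ I) (hac : M.occupancy (pol 0) μ ≪ M.occupancy (pol k) μ)
    (hv : ∀ᵐ x ∂(M.occupancy (pol k) μ), (val (k + 1) 0).1 x = M.returnLaw (pol k) x.1 x.2) :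
    ∀ᵐ x ∂(M.occupancy (pol 0) μ), ∀ a,
      (pol (k + 1)).prob x.1 a = softProb M.α (fun y => M.Q (pol k) y.1 y.2) x.1 a := by
  have hac' : M.occupancy (pol k) μ ≪ M.occupancy (pol 0) μ :=
    M.occupancy_absolutelyContinuous (.of_forall fun x => absolutelyContinuous_of_pos (hpos x.1))
  have hmean : ∀ᵐ x ∂(M.occupancy (pol 0) μ), ∀ a,
      ∫ z, z ∂((val (k + 1) 0).1 (x.1, a)) = M.Q (pol k) x.1 a := by
    filter_upwards [M.ae_forall_action hpos (hac.ae_le hv)] with x hx a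
    rw [hx a, ← integral_returnKernel (pol k) (x.1, a), returnKernel_apply]
  obtain ⟨B, hB⟩ := (bddMeas_Q hR (pol k)).bounded
  have hbound : ∀ᵐ x ∂(M.occupancy (pol k) μ), ∀ a,
      |∫ z, z ∂((val (k + 1) 0).1 (x.1, a))| ≤ B := by
    filter_upwards [hac'.ae_le hmean] with x hx a
    rw [hx a]
    exact hB (x.1, a)
  filter_upwards [hmean, hac.ae_le (ae_eq_softProb_of_improveObjective_ge hbound
    (h.improve k μ hμ))] with x h1 h2 a
  rw [h2 a, softProb_congr (q' := fun y => M.Q (pol k) y.1 y.2) h1]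

/-- Softmax weights are positive, so sampling stays as rich as at the start although `pol k` is
arbitrary on null sets. The reverse domination, from positivity of `pol 0`, carries the evaluated
law over to the sampling measure of the next policy. -/
theorem invariant (hpos : ∀ s a, 0 < (pol 0).prob s a) {C : ℝ≥0}
    (hC : ∀ x, ∫⁻ z, ‖z‖ₑ ∂((val 0 0).1 x) ≤ C) (k : ℕ) :
    (∀ μ ∈ I, M.occupancy (pol 0) μ ≪ M.occupancy (pol k) μ) ∧
    ∃ (W : ReturnDist S A) (C : ℝ≥0), (∀ x, ∫⁻ z, ‖z‖ₑ ∂(W.1 x) ≤ C) ∧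
      ∀ μ ∈ I, ∀ᵐ x ∂(M.occupancy (pol k) μ), (val k 0).1 x = W.1 x := by
  induction k with
  | zero => exact ⟨fun _ _ => .rfl, val 0 0, C, hC, fun _ _ => .of_forall fun _ => rfl⟩
  | succ k ih =>
    obtain ⟨hac, W, C', hW, h0⟩ := ih
    have hev := h.evaluation hR hW h0
    obtain ⟨C'', hC''⟩ := exists_moment_bound hR
    refine ⟨fun μ hμ => M.occupancy_absolutelyContinuous ?_, M.returnKernel (pol k), C'',
      hC'' _, fun μ hμ => ?_⟩
    · filter_upwards [h.improvement hR hpos hμ (hac μ hμ)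
        ((hev μ hμ).mono fun x hx => hx.2)] with x hx
      refine absolutelyContinuous_of_pos fun a => ?_
      rw [hx a]
      exact softProb_pos _ _ _ _
    · have hac' : M.occupancy (pol (k + 1)) μ ≪ M.occupancy (pol 0) μ :=
        M.occupancy_absolutelyContinuous
          (.of_forall fun x => absolutelyContinuous_of_pos (hpos x.1))
      filter_upwards [(hac'.trans (hac μ hμ)).ae_le (hev μ hμ)] with x hx
      rw [hx.2, returnKernel_apply]

theorem converges (hpos : ∀ s a, 0 < (pol 0).prob s a) {C : ℝ≥0}
    (hC : ∀ x, ∫⁻ z, ‖z‖ₑ ∂((val 0 0).1 x) ≤ C) (hI : M.Explores (pol 0) I) {q : S × A → ℝ}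
    (hq : BddMeas q) (hfix : ∀ x, q x = M.backup (softValue M.α q) x) :
    (∀ k, ∀ μ ∈ I, ∀ᵐ x ∂(M.occupancy (pol k) μ),
      WeaklyConverges (fun i => (val k i).1 x) (M.returnLaw (pol k) x.1 x.2) ∧
      (val (k + 1) 0).1 x = M.returnLaw (pol k) x.1 x.2) ∧
    (∀ μ ∈ I, ∀ᵐ x ∂(M.occupancy (pol 0) μ), ∀ a,
      Filter.Tendsto (fun k => (pol k).prob x.1 a) Filter.atTop (nhds (softProb M.α q x.1 a))) ∧
    (∀ s a, Filter.Tendsto (fun k => M.Q (pol k) s a) Filter.atTop (nhds (q (s, a)))) := by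
  have hev : ∀ k, ∀ μ ∈ I, ∀ᵐ x ∂(M.occupancy (pol k) μ),
      WeaklyConverges (fun i => (val k i).1 x) (M.returnLaw (pol k) x.1 x.2) ∧
      (val (k + 1) 0).1 x = M.returnLaw (pol k) x.1 x.2 := by
    intro k
    obtain ⟨_, W, C', hW, h0⟩ := h.invariant hR hpos hC k
    exact h.evaluation hR hW h0
  have himp : ∀ k, ∀ μ ∈ I, ∀ᵐ x ∂(M.occupancy (pol 0) μ), ∀ a,
      (pol (k + 1)).prob x.1 a = softProb M.α (fun y => M.Q (pol k) y.1 y.2) x.1 a := fun k μ hμ =>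
    h.improvement hR hpos hμ ((h.invariant hR hpos hC k).1 μ hμ)
      ((hev k μ hμ).mono fun x hx => hx.2)
  have hQ : ∀ x : S × A,
      Filter.Tendsto (fun k => M.Q (pol k) x.1 x.2) Filter.atTop (nhds (q x)) := by
    refine tendsto_Q_of_improve hR hq hfix fun k => M.ae_transition_of_explores hI ?_ (himp k)
    rw [Set.ofPred_forall]
    exact MeasurableSet.iInter fun a => measurableSet_eq_fun ((pol (k + 1)).measurable_prob_left a)
      (measurable_softProb (measurable_Q (pol k)) a)
  refine ⟨hev, fun μ hμ => ?_, fun s a => hQ (s, a)⟩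
  filter_upwards [ae_all_iff.2 fun k => himp k μ hμ] with x hx a
  -- The initial policy need not be a softmax; the formula starts at index 1.
  rw [← Filter.tendsto_add_atTop_iff_nat 1]
  simp_rw [hx]
  exact tendsto_softProb (q := fun k y => M.Q (pol k) y.1 y.2) (fun b => hQ (x.1, b)) a

end IsPolicyIteration

end DecisionProcess

/-! ## A measurable feature map with injective sums -/

theorem summable_digits {N : ℕ} {d : ℕ → ℤ} (hd : ∀ n, |d n| ≤ N) :
    Summable fun n => (d n : ℝ) * ((N + 2 : ℝ)⁻¹) ^ n := by
  have hb : (N + 2 : ℝ)⁻¹ < 1 := inv_lt_one_of_one_lt₀ (by have := N.cast_nonneg (α := ℝ); linarith)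
  refine Summable.of_norm_bounded
    ((summable_geometric_of_lt_one (by positivity) hb).mul_left (N : ℝ)) fun n => ?_
  rw [norm_mul, Real.norm_of_nonneg (by positivity : (0 : ℝ) ≤ ((N + 2 : ℝ)⁻¹) ^ n)]
  gcongr
  rw [Real.norm_eq_abs]
  exact_mod_cast hd n

/-- Expansions in base `N + 2` with signed digits of absolute value at most `N` are unique. -/
theorem digits_eq_zero {N : ℕ} {d : ℕ → ℤ} (hd : ∀ n, |d n| ≤ N)
    (h : ∑' n, (d n : ℝ) * ((N + 2 : ℝ)⁻¹) ^ n = 0) (m : ℕ) : d m = 0 := by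
  have hN := N.cast_nonneg (α := ℝ)
  set b : ℝ := (N + 2 : ℝ)⁻¹ with hb
  have hb0 : 0 < b := by positivity
  have hb1 : b < 1 := inv_lt_one_of_one_lt₀ (by linarith)
  have key : ∀ d : ℕ → ℤ, (∀ n, |d n| ≤ N) → ∑' n, (d n : ℝ) * b ^ n = 0 →
      d 0 = 0 ∧ ∑' n, (d (n + 1) : ℝ) * b ^ n = 0 := by
    intro d hd h
    have h1 := (summable_digits hd).tsum_eq_zero_add
    rw [← hb, h] at h1
    have h2 : ∑' n, (d (n + 1) : ℝ) * b ^ (n + 1) = b * ∑' n, (d (n + 1) : ℝ) * b ^ n := by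
      rw [← tsum_mul_left]
      exact tsum_congr fun n => by ring
    rw [h2, pow_zero, mul_one] at h1
    have h3 : ‖∑' n, (d (n + 1) : ℝ) * b ^ n‖ ≤ N * (1 - b)⁻¹ := by
      refine tsum_of_norm_bounded ((hasSum_geometric_of_lt_one hb0.le hb1).mul_left (N : ℝ))
        fun n => ?_
      rw [norm_mul, Real.norm_of_nonneg (by positivity : (0 : ℝ) ≤ b ^ n)]
      gcongr
      rw [Real.norm_eq_abs]
      exact_mod_cast hd (n + 1)
    -- Everything after the leading digit contributes at most N / (N + 1) in absolute value, so an
    -- integer leading digit in a zero sum must vanish.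
    have h4 : b * (N * (1 - b)⁻¹) < 1 := by
      have : b * (N * (1 - b)⁻¹) = N / (N + 1) := by
        have h5 : 1 - b = (N + 1) / (N + 2) := by rw [hb]; field_simp; ring
        rw [h5, hb]
        field_simp
      rw [this, div_lt_one (by positivity)]
      linarith
    have h0 : d 0 = 0 := by
      have h5 : |(d 0 : ℝ)| < 1 := by
        rw [show (d 0 : ℝ) = -(b * ∑' n, (d (n + 1) : ℝ) * b ^ n) by linarith, abs_neg, abs_mul,
          abs_of_pos hb0]
        exact (mul_le_mul_of_nonneg_left h3 hb0.le).trans_lt h4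
      have : |d 0| < 1 := by exact_mod_cast h5
      exact Int.abs_lt_one_iff.1 this
    refine ⟨h0, ?_⟩
    rw [h0, Int.cast_zero, zero_add] at h1
    exact (mul_eq_zero.1 h1.symm).resolve_left hb0.ne'
  induction m generalizing d with
  | zero => exact (key d hd h).1
  | succ m ih => exact ih (d := fun n => d (n + 1)) (fun n => hd (n + 1)) (key d hd h).2

/-- On a second-countable `T1` space there is a measurable function whose sums over sets of at most
`N` points determine these sets. -/
theorem exists_measurable_sum_injective (X : Type*) [TopologicalSpace X] [T1Space X]
    [SecondCountableTopology X] [MeasurableSpace X] [OpensMeasurableSpace X] [Nonempty X] (N : ℕ) :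
    ∃ h : X → ℝ, Measurable h ∧ ∀ s t : Finset X, s.card ≤ N → t.card ≤ N →
      ∑ x ∈ s, h x = ∑ x ∈ t, h x → s = t := by
  classical
  obtain ⟨ℬ, hc, -, hℬ⟩ := TopologicalSpace.exists_countable_basis X
  have hne : ℬ.Nonempty := by
    obtain ⟨v, hv, -⟩ := hℬ.exists_subset_of_mem_open (Set.mem_univ (Classical.arbitrary X))
      isOpen_univ
    exact ⟨v, hv⟩
  obtain ⟨E, rfl⟩ := hc.exists_eq_range hne
  have hE : ∀ n, IsOpen (E n) := fun n => hℬ.isOpen ⟨n, rfl⟩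
  set b : ℝ := (N + 2 : ℝ)⁻¹ with hb
  have hb0 : 0 ≤ b := by positivity
  have hb1 : b < 1 := inv_lt_one_of_one_lt₀ (by have := N.cast_nonneg (α := ℝ); linarith)
  let e : ℕ → X → ℝ := fun n x => (if x ∈ E n then 1 else 0) * b ^ n
  have hes : ∀ x, Summable fun n => e n x := by
    intro x
    refine Summable.of_norm_bounded (summable_geometric_of_lt_one hb0 hb1) fun n => ?_
    by_cases hx : x ∈ E n <;> simp [e, hx, abs_of_nonneg hb0, pow_nonneg hb0]
  have hsum : ∀ s : Finset X, ∑ x ∈ s, ∑' n, e n x =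
      ∑' n, ((s.filter fun x => x ∈ E n).card : ℝ) * b ^ n := by
    intro s
    rw [← Summable.tsum_finsetSum fun x _ => hes x]
    refine tsum_congr fun n => ?_
    simp only [e]
    rw [← Finset.sum_mul, Finset.sum_boole]
  refine ⟨fun x => ∑' n, e n x, Measurable.tsum fun n =>
    (Measurable.ite (hE n).measurableSet measurable_const measurable_const).mul_const _, ?_⟩
  intro s t hs ht hst
  rw [hsum, hsum] at hst
  have hcard : ∀ (s : Finset X), s.card ≤ N → ∀ n,
      (s.filter fun x => x ∈ E n).card ≤ N := fun s hs n => (Finset.card_filter_le _ _).trans hs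
  have hS : ∀ (s : Finset X), s.card ≤ N →
      Summable fun n => ((s.filter fun x => x ∈ E n).card : ℝ) * b ^ n := by
    intro s hs
    have := summable_digits (N := N) (d := fun n => ((s.filter fun x => x ∈ E n).card : ℤ))
      fun n => by rw [Nat.abs_cast]; exact_mod_cast hcard s hs n
    simpa [hb] using this
  have hdig : ∀ n, (s.filter fun x => x ∈ E n).card = (t.filter fun x => x ∈ E n).card := by
    intro n
    -- Both counts lie between 0 and N, so their difference is a signed digit.
    have := digits_eq_zero (N := N) (d := fun n => ((s.filter fun x => x ∈ E n).card : ℤ)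
      - ((t.filter fun x => x ∈ E n).card : ℤ)) (fun n => by
        have := hcard s hs n
        have := hcard t ht n
        rw [abs_le]
        omega) (by
        push_cast
        simp_rw [sub_mul]
        rw [(hS s hs).tsum_sub (hS t ht), hst, sub_self]) n
    omega
  have hsub : ∀ s t : Finset X,
      (∀ n, (s.filter fun x => x ∈ E n).card = (t.filter fun x => x ∈ E n).card) → s ⊆ t := by
    intro s t hst x hx
    by_contra hxt
    -- The finite set `t` is closed, so some basic set contains `x` and misses `t`: its count is 0
    -- for `t` but positive for `s`.
    obtain ⟨_, ⟨n, rfl⟩, hxn, hn⟩ := hℬ.exists_subset_of_mem_open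
      (show x ∈ ((t : Set X))ᶜ by simpa using hxt) t.finite_toSet.isClosed.isOpen_compl
    have h1 : (t.filter fun y => y ∈ E n) = ∅ :=
      Finset.filter_eq_empty_iff.2 fun y hy hyn => hn hyn hy
    have h2 := hst n
    rw [h1, Finset.card_empty, Finset.card_eq_zero, Finset.filter_eq_empty_iff] at h2
    exact h2 hx hxn
  exact (hsub s t hdig).antisymm (hsub t s fun n => (hdig n).symm)

/-! ## The encoding is universal -/

section Encoding

variable {d₁ : ℕ} {D : Set (Fin d₁ → ℝ)} {N d₂ d₃ : ℕ}

theorem measurable_ofTuple (m : Fin N) :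
    Measurable (Observation.ofTuple m : _ → Observation D N d₂) := by
  intro s hs
  rw [MeasurableSpace.measurableSet_iInf] at hs
  exact hs m

/-- An injective real function orders the points, which selects one canonical enumeration of each
finite set. -/
theorem exists_strictMono_tuple {g : (Fin d₁ → ℝ) → ℝ} (hg : Function.Injective g)
    (O : Observation D N d₂) :
    ∃ (m : Fin N) (t : (Fin (m + 1) → D) × (Fin d₂ → ℝ)),
      StrictMono (fun i => g (t.1 i)) ∧ Observation.ofTuple m t = O := by
  classical
  have hpos := O.nonempty.card_pos
  have hle := O.card_le
  set F := O.vehicles.image g with hF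
  have hcard : F.card = O.vehicles.card := Finset.card_image_of_injective _ hg
  obtain ⟨m, hm⟩ : ∃ m : Fin N, F.card = m + 1 :=
    ⟨⟨O.vehicles.card - 1, by omega⟩, by simp only; omega⟩
  set f := F.orderEmbOfFin hm
  have hf : ∀ i, ∃ x ∈ O.vehicles, g x = f i := fun i =>
    Finset.mem_image.1 (F.orderEmbOfFin_mem hm i)
  choose x hx hgx using hf
  refine ⟨m, (fun i => ⟨x i, O.mem_domain _ (hx i)⟩, O.other), ?_, ?_⟩
  · simp only [hgx]
    exact f.strictMono
  · refine Observation.ext ?_ rfl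
    ext y
    simp only [Observation.ofTuple, Finset.mem_image, Finset.mem_univ, true_and]
    constructor
    · rintro ⟨i, rfl⟩
      exact hx i
    · intro hy
      have : g y ∈ Set.range f := by
        rw [Finset.range_orderEmbOfFin]
        exact Finset.mem_coe.2 (Finset.mem_image_of_mem g hy)
      obtain ⟨i, hi⟩ := this
      exact ⟨i, hg ((hgx i).trans hi)⟩

/-- Lusin–Souslin: an injective Borel image of a Borel subset of a standard Borel space is Borel.
Tuples represent sets redundantly, so the theorem is applied to tuples sorted by `g`, on which the
encoding is injective. -/
theorem measurableEmbedding_esc {h : Feature d₁ d₃} (hD : MeasurableSet D)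
    (hinj : Function.Injective (esc h.1 : Observation D N d₂ → State d₃ d₂))
    {g : (Fin d₁ → ℝ) → ℝ} (hgm : Measurable g) (hg : Function.Injective g) :
    MeasurableEmbedding (esc h.1 : Observation D N d₂ → State d₃ d₂) := by
  classical
  have := hD.standardBorel
  refine ⟨hinj, measurable_esc h.2, fun {B} hB => ?_⟩
  let T : (m : Fin N) → Set ((Fin (m + 1) → D) × (Fin d₂ → ℝ)) := fun m =>
    {t | StrictMono fun i => g (t.1 i)}
  have hT : ∀ m, MeasurableSet (T m) := by
    intro m
    have hm : ∀ i : Fin (m + 1), Measurable fun t : (Fin (m + 1) → D) × (Fin d₂ → ℝ) =>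
      g (t.1 i) := fun i =>
        hgm.comp (measurable_subtype_coe.comp ((measurable_pi_apply i).comp measurable_fst))
    simp only [T, StrictMono, Set.ofPred_forall]
    exact MeasurableSet.iInter fun i => MeasurableSet.iInter fun j => MeasurableSet.iInter fun _ =>
      measurableSet_lt (hm i) (hm j)
  have heq : esc h.1 '' B = ⋃ m : Fin N, (fun t => esc h.1 (Observation.ofTuple (D := D) m t)) ''
      (Observation.ofTuple m ⁻¹' B ∩ T m) := by
    ext y
    simp only [Set.mem_image, Set.mem_iUnion]
    constructor
    · rintro ⟨O, hO, rfl⟩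
      obtain ⟨m, t, ht, rfl⟩ := exists_strictMono_tuple hg O
      exact ⟨m, t, ⟨hO, ht⟩, rfl⟩
    · rintro ⟨m, t, ⟨ht, -⟩, rfl⟩
      exact ⟨_, ht, rfl⟩
  rw [heq]
  refine MeasurableSet.iUnion fun m => ?_
  refine ((measurable_ofTuple m hB).inter (hT m)).image_of_measurable_injOn
    ((measurable_esc h.2).comp (measurable_ofTuple m)) ?_
  rintro ⟨t, u⟩ ⟨-, ht⟩ ⟨t', u'⟩ ⟨-, ht'⟩ htt
  have hO := hinj htt
  have hu : u = u' := congrArg Observation.other hO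
  have hv : Finset.univ.image (fun i => (t i : Fin d₁ → ℝ)) =
      Finset.univ.image (fun i => (t' i : Fin d₁ → ℝ)) := congrArg Observation.vehicles hO
  -- Two strictly increasing enumerations of the same set of reals coincide.
  have hr : Set.range (fun i => g (t i)) = Set.range (fun i => g (t' i)) := by
    have := congrArg (fun s : Finset (Fin d₁ → ℝ) => g '' (s : Set (Fin d₁ → ℝ))) hv
    simpa [← Set.range_comp, Function.comp_def] using this
  have hgt := (StrictMono.range_inj ht ht').1 hr
  have htt : t = t' := by
    funext i
    exact Subtype.ext (hg (congrFun hgt i))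
  rw [htt, hu]

theorem exists_measurableEmbedding_esc (hN : 1 ≤ N) (hd₃ : 1 ≤ d₃) (hD : MeasurableSet D) :
    ∃ h : Feature d₁ d₃, MeasurableEmbedding (esc h.1 : Observation D N d₂ → State d₃ d₂) := by
  obtain ⟨g, hgm, hg⟩ := exists_measurable_sum_injective (Fin d₁ → ℝ) N
  have hginj : Function.Injective g := by
    intro x y hxy
    exact Finset.singleton_injective (hg {x} {y} (by simpa) (by simpa) (by simpa using hxy))
  let h : Feature d₁ d₃ := ⟨fun x _ => g x, measurable_pi_lambda _ fun _ => hgm⟩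
  refine ⟨h, measurableEmbedding_esc hD (fun O O' hO => ?_) hgm hginj⟩
  have h1 : ∑ x ∈ O.vehicles, g x = ∑ x ∈ O'.vehicles, g x := by
    have := congrFun (congrArg Prod.fst hO) ⟨0, hd₃⟩
    simpa [esc, h, Finset.sum_apply] using this
  exact Observation.ext (hg _ _ O.card_le O'.card_le h1) (congrArg Prod.snd hO)

variable {A : Type*} [MeasurableSpace A]

/-- Every return distribution on observations factors through an encoding that is a measurable
embedding. -/
theorem exists_encodeReturn_eq {h : Feature d₁ d₃}
    (hh : MeasurableEmbedding (esc h.1 : Observation D N d₂ → State d₃ d₂))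
    (Z₀ : ReturnDist (State d₃ d₂) A) (Z : ReturnDist (Observation D N d₂) A) :
    ∃ Z', encodeReturn D N h Z' = Z := by
  rcases isEmpty_or_nonempty (Observation D N d₂) with hO | hO
  · exact ⟨Z₀, Subtype.ext (Kernel.ext fun x => hO.elim x.1)⟩
  -- A measurable left inverse of the encoding; pulling `Z` back along it gives the factorisation.
  -- It needs some observation as a value off the range.
  · obtain ⟨r, hr, hrh⟩ := hh.exists_measurable_extend measurable_id fun _ => hO
    refine ⟨⟨Z.1.comap (fun x => (r x.1, x.2))
      ((hr.comp measurable_fst).prodMk measurable_snd), inferInstance⟩, ?_⟩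
    refine Subtype.ext (Kernel.ext fun x => ?_)
    have : r (esc h.1 x.1) = x.1 := congrFun hrh x.1
    simp only [encodeReturn, Kernel.comap_apply, this]

theorem encodePolicy_softPolicy [Fintype A] [Nonempty A] (h : Feature d₁ d₃) (α : ℝ)
    (Z : ReturnDist (State d₃ d₂) A) :
    encodePolicy D N h (softPolicy α (fun y => ∫ z, z ∂(Z.1 y)) (DecisionProcess.measurable_integral_returnDist Z)) =
      softPolicy α (fun y => ∫ z, z ∂((encodeReturn D N h Z).1 y))
        (DecisionProcess.measurable_integral_returnDist _) :=
  rfl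

end Encoding

/-! ## Runs of encoding distributional policy iteration -/

theorem WeaklyConverges.unique {ν : ℕ → Measure ℝ} {m m' : Measure ℝ} [IsFiniteMeasure m]
    [IsFiniteMeasure m'] (h : WeaklyConverges ν m) (h' : WeaklyConverges ν m') : m = m' :=
  ext_of_forall_integral_eq_of_IsFiniteMeasure fun f => tendsto_nhds_unique (h f) (h' f)

section Run

open DecisionProcess

variable {d₁ d₂ d₃ N : ℕ} {D : Set (Fin d₁ → ℝ)} {A : Type*} [Fintype A] [Nonempty A]
  [MeasurableSpace A] [MeasurableSingletonClass A] {M : DecisionProcess (Observation D N d₂) A}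
  {Φ Θ Ω : Type*} {net : Networks d₁ d₂ d₃ A Φ Θ Ω}
  {I : Set (ProbabilityMeasure (Observation D N d₂))} {θ₀ : Θ} {φ₀ : Φ} {ω₀ : Ω}

omit [Fintype A] [Nonempty A] [MeasurableSingletonClass A] in
-- A single feature parameter serves all return distributions, so a run may keep it fixed.
theorem Networks.OverParameterized.exists_obsReturn_eq (hnet : net.OverParameterized) (hN : 1 ≤ N)
    (hd₃ : 1 ≤ d₃) (hD : MeasurableSet D) (θ₀ : Θ) :
    ∃ φ, ∀ Z, ∃ θ, net.obsReturn D N φ θ = Z := by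
  obtain ⟨h, hh⟩ := exists_measurableEmbedding_esc (N := N) (d₂ := d₂) hN hd₃ hD
  obtain ⟨φ, rfl⟩ := hnet.feature h
  refine ⟨φ, fun Z => ?_⟩
  obtain ⟨Z', hZ'⟩ := exists_encodeReturn_eq hh (net.value θ₀) Z
  obtain ⟨θ, rfl⟩ := hnet.value Z'
  exact ⟨θ, hZ'⟩

omit [MeasurableSingletonClass A] in
theorem Networks.OverParameterized.exists_obsPolicy_eq (hnet : net.OverParameterized) (α : ℝ)
    (θ : Θ) : ∃ ω, ∀ φ, net.obsPolicy D N φ ω =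
      softPolicy α (fun y => ∫ z, z ∂((net.obsReturn D N φ θ).1 y))
        (measurable_integral_returnDist _) := by
  obtain ⟨ω, hω⟩ := hnet.policy
    (softPolicy α (fun y => ∫ z, z ∂((net.value θ).1 y)) (measurable_integral_returnDist _))
  refine ⟨ω, fun φ => ?_⟩
  rw [Networks.obsPolicy, hω, encodePolicy_softPolicy]
  rfl

/-- The exact Bellman image is representable and has objective 0, so every minimiser has objective
0. The softmax competitor in the improvement step uses the run's own feature parameter. -/
theorem IsEncodingDPI.isPolicyIteration {P : Params Φ Θ Ω}
    (hP : IsEncodingDPI M net I θ₀ φ₀ ω₀ P) (hnet : net.OverParameterized)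
    {φs : Φ} (hφs : ∀ Z, ∃ θ, net.obsReturn D N φs θ = Z) :
    M.IsPolicyIteration I (P.pol net D N) (P.val net D N) where
  eval_step k i μ hμ := by
    obtain ⟨θ, hθ⟩ := hφs (M.bellmanKernel (P.pol net D N k) (P.val net D N k i))
    have := hP.eval_step k i μ hμ θ φs
    rw [hθ, evalObjective_bellmanKernel] at this
    exact ae_eq_of_evalObjective_eq_zero (le_antisymm this zero_le)
  eval_limit := hP.eval_limit
  improve k μ hμ := by
    obtain ⟨ω, hω⟩ := hnet.exists_obsPolicy_eq (D := D) (N := N) M.α (P.θ (k + 1) 0)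
    have := hP.improve k μ hμ ω
    rwa [hω] at this

theorem exists_isEncodingDPI {R : ℝ} (hR : ∀ O a O', |M.reward O a O'| ≤ R)
    (hnet : net.OverParameterized) {φs : Φ} (hφs : ∀ Z, ∃ θ, net.obsReturn D N φs θ = Z)
    {C : ℝ≥0} (hC : ∀ x, ∫⁻ z, ‖z‖ₑ ∂((net.obsReturn D N φ₀ θ₀).1 x) ≤ C) :
    ∃ P, IsEncodingDPI M net I θ₀ φ₀ ω₀ P := by
  choose code hcode using hφs
  choose soft hsoft using fun θ => hnet.exists_obsPolicy_eq (D := D) (N := N) M.α θ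
  -- Each evaluation is taken to deliver the exact return law, and its softmax is the next policy.
  -- Within an evaluation, `V` consists of exact Bellman iterates; index 0 is separate because `φ₀`
  -- need not be an embedding feature.
  let start : ℕ → Φ × Θ × Ω := fun k => Nat.rec (φ₀, θ₀, ω₀) (fun _ w =>
    (φs, code (M.returnKernel (net.obsPolicy D N w.1 w.2.2)),
      soft (code (M.returnKernel (net.obsPolicy D N w.1 w.2.2))))) k
  let V : ℕ → ℕ → ReturnDist (Observation D N d₂) A := fun k i =>
    (M.bellmanKernel (net.obsPolicy D N (start k).1 (start k).2.2))^[i]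
      (net.obsReturn D N (start k).1 (start k).2.1)
  let P : Params Φ Θ Ω :=
    { θ := fun k i => if i = 0 then (start k).2.1 else code (V k i)
      φ := fun k i => if i = 0 then (start k).1 else φs
      ω := fun k => (start k).2.2 }
  have hpol : ∀ k, P.pol net D N k = net.obsPolicy D N (start k).1 (start k).2.2 := fun k => rfl
  have hval : ∀ k i, P.val net D N k i = V k i := by
    intro k i
    rcases Nat.eq_zero_or_pos i with rfl | hi
    · rfl
    · simp only [Params.val, P, if_neg hi.ne', hcode]
  have hval0 : ∀ k, P.val net D N (k + 1) 0 = M.returnKernel (P.pol net D N k) := fun k =>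
    hcode _
  have hpols : ∀ k, P.pol net D N (k + 1) =
      softPolicy M.α (fun y => ∫ z, z ∂((P.val net D N (k + 1) 0).1 y))
        (measurable_integral_returnDist _) := fun k => hsoft _ _
  have hmoment : ∀ k, ∃ C : ℝ≥0, ∀ x, ∫⁻ z, ‖z‖ₑ ∂((V k 0).1 x) ≤ C := by
    intro k
    cases k with
    | zero => exact ⟨C, hC⟩
    | succ k =>
      obtain ⟨C', hC'⟩ := exists_moment_bound hR
      refine ⟨C', fun x => ?_⟩
      have := hC' (P.pol net D N k) x
      rwa [← hval0 k, hval] at this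
  refine ⟨P, rfl, rfl, rfl, fun k i μ _ θ φ => ?_, fun k Z hZ μ hμ => ?_, fun k μ _ ω => ?_⟩
  · have : P.val net D N k (i + 1) =
        M.bellmanKernel (P.pol net D N k) (P.val net D N k i) := by
      rw [hval, hval, hpol]
      exact Function.iterate_succ_apply' _ _ _
    rw [this, evalObjective_bellmanKernel]
    exact zero_le
  -- The Bellman iterates also converge to the return law, so by uniqueness of weak limits any other
  -- candidate limit agrees with it.
  · obtain ⟨C', hC'⟩ := hmoment k
    filter_upwards [hZ μ hμ] with x hx
    have h := weaklyConverges_iterate hR (P.pol net D N k) hC' x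
    rw [← returnKernel_apply] at h
    rw [hval0]
    simp_rw [hval] at hx
    exact h.unique hx
  · obtain ⟨B, hB⟩ := (bddMeas_Q hR (P.pol net D N k)).bounded
    rw [hpols]
    refine improveObjective_le_softPolicy (B := B) (.of_forall fun x a => ?_) _
    rw [hval0, integral_returnKernel]
    exact hB (x.1, a)

end Run

end EncodingDPI

/-! ### Main theorem -/

theorem theorem1 {d₁ d₂ d₃ N : ℕ} (hN : 1 ≤ N) (hd₃ : N * d₁ + 1 ≤ d₃)
    {D : Set (Fin d₁ → ℝ)} (hD : MeasurableSet D)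
    {A : Type*} [Finite A] [MeasurableSpace A] [MeasurableSingletonClass A]
    (M : DecisionProcess (Observation D N d₂) A)
    (hr : ∃ R : ℝ, ∀ O a O', |M.reward O a O'| ≤ R)
    {Φ Θ Ω : Type*} (net : Networks d₁ d₂ d₃ A Φ Θ Ω) (hnet : net.OverParameterized)
    (I : Set (ProbabilityMeasure (Observation D N d₂)))
    (θ₀ : Θ) (φ₀ : Φ) (ω₀ : Ω)
    (hω₀ : ∀ O a, 0 < (net.obsPolicy D N φ₀ ω₀).prob O a)
    (hθ₀ : ∃ C : ℝ≥0, ∀ x, ∫⁻ z, ‖z‖ₑ ∂((net.obsReturn D N φ₀ θ₀).1 x) ≤ C)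
    (hI : M.Explores (net.obsPolicy D N φ₀ ω₀) I) :
    ∃ πstar : Policy (Observation D N d₂) A,
      (∀ (π : Policy (Observation D N d₂) A) O a, M.Q π O a ≤ M.Q πstar O a) ∧
      (∃ P, IsEncodingDPI M net I θ₀ φ₀ ω₀ P) ∧
      ∀ P, IsEncodingDPI M net I θ₀ φ₀ ω₀ P →
        (∀ k, ∀ μ ∈ I, ∀ᵐ x ∂(M.occupancy (P.pol net D N k) μ),
          WeaklyConverges (fun i => (P.val net D N k i).1 x)
            (M.returnLaw (P.pol net D N k) x.1 x.2) ∧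
          (P.val net D N (k + 1) 0).1 x = M.returnLaw (P.pol net D N k) x.1 x.2) ∧
        (∀ μ ∈ I, ∀ᵐ x ∂(M.occupancy (net.obsPolicy D N φ₀ ω₀) μ), ∀ a,
          Filter.Tendsto (fun k => (P.pol net D N k).prob x.1 a) Filter.atTop
            (nhds (πstar.prob x.1 a))) ∧
        (∀ O a, Filter.Tendsto (fun k => M.Q (P.pol net D N k) O a) Filter.atTop
          (nhds (M.Q πstar O a))) := by
  cases nonempty_fintype A
  -- The initial policy network supplies a probability law on `A`, here at state 0.
  have hA : Nonempty A := nonempty_of_isProbabilityMeasure ((net.policy ω₀).1 0)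
  obtain ⟨R, hR⟩ := hr
  obtain ⟨C, hC⟩ := hθ₀
  obtain ⟨φs, hφs⟩ := hnet.exists_obsReturn_eq hN (le_trans (Nat.le_add_left 1 _) hd₃) hD θ₀
  obtain ⟨q, hq, hfix⟩ := DecisionProcess.exists_soft_optimal hR
  refine ⟨softPolicy M.α q hq.measurable, fun π O a => ?_,
    exists_isEncodingDPI hR hnet hφs hC, fun P hP => ?_⟩
  · rw [DecisionProcess.Q_softPolicy hR hq hfix (O, a)]
    exact DecisionProcess.Q_le_of_soft_optimal hR hq hfix π (O, a)
  · have hpol : P.pol net D N 0 = net.obsPolicy D N φ₀ ω₀ := by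
      rw [Params.pol, hP.init_feature, hP.init_policy]
    have hval : P.val net D N 0 0 = net.obsReturn D N φ₀ θ₀ := by
      rw [Params.val, hP.init_feature, hP.init_value]
    have h := (hP.isPolicyIteration hnet hφs).converges hR (by rwa [hpol]) (C := C)
      (by rwa [hval]) (by rwa [hpol]) hq hfix
    rw [hpol] at h
    simp_rw [softPolicy_prob]
    refine ⟨h.1, h.2.1, fun O a => ?_⟩
    rw [DecisionProcess.Q_softPolicy hR hq hfix (O, a)]
    exact h.2.2 O a
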